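/- **Proposition (Connecting Lemma).** Conventions. The $r$-th power of a graph $F$ has the same vertex set as $F$, and two distinct vertices are adjacent in it if and only if their distance in $F$ is at most $r$. An $r$-path in a graph $H$ is a (not necessarily induced) copy in $H$ of the $r$-th power of a path. An ordered $r$-clique of $H$ is a sequence of $r$ distinct, pairwise adjacent vertices of $H$. An $r$-path with vertices $v_1,\dots,v_m$ (in the order of the path), $m\ge r$, connects the ordered $r$-cliques $(v_1,\dots,v_r)$ and $(v_{m-r+1},\dots,v_m)$; its internal vertices are those of its vertices that lie in neither of these two cliques. $G(n,p)$ is the binomial random graph on $\{1,\dots,n\}$, in which every pair is an edge independently with probability $p$. For every integer $k\ge 0$ and every real $\varepsilon>0$ there exists a real $C>1$ such that the following holds. Let $(G_n)_{n\in\mathbb N}$ be a sequence of graphs, $G_n$ having vertex set $V_n=\{1,\dots,n\}$, and let $p\colon\mathbb N\to[0,1]$, such that for all sufficiently large $n$ $$\delta(G_n)\ \ge\ \Big(\frac{k}{k+1}+\varepsilon\Big)n\qquad\text{and}\qquad p(n)\ \ge\ \frac Cn .$$ Then, with probability tending to $1$ as $n\to\infty$, the graph $H=G_n\cup G(n,p(n))$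 has the following property: for every set $Z\subseteq V_n$ with $|Z|\le \varepsilon n/2$ and every pair of vertex-disjoint ordered $(k+1)$-cliques $K,K'$ of $H$, there exists a $(k+1)$-path in $H$ that connects $K$ and $K'$ and has exactly $(k+1)2^{k+1}$ internal vertices, all of which lie in $V_n\setminus Z$. -/

import Mathlib

/-- The `r`-th power of a graph `H`: the graph on the same vertex set in which two distinct
vertices are adjacent iff their distance in `H` is at most `r` (the distance between vertices in
different components is infinite). -/
def SimpleGraph.power {V : Type*} (H : SimpleGraph V) (r : ℕ) : SimpleGraph V where
  Adj u v := u ≠ v ∧ H.edist u v ≤ (r : ℕ∞)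
  symm := ⟨fun _ _ h => ⟨h.1.symm, by rw [SimpleGraph.edist_comm]; exact h.2⟩⟩
  loopless := ⟨fun _ h => h.1 rfl⟩

/-- `K 0, …, K (r - 1)` is an ordered `r`-clique of `H`: its vertices are distinct and pairwise
adjacent in `H`. -/
def IsOrderedClique {V : Type*} (H : SimpleGraph V) {r : ℕ} (K : Fin r → V) : Prop :=
  ∀ i j, i ≠ j → K i ≠ K j ∧ H.Adj (K i) (K j)

/-- An `r`-path in `H`: a copy in `H` of the `r`-th power of a path on `order` vertices.
The vertices of the `r`-path are `copy 0, …, copy (order - 1)`, in this order. -/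
structure PowerPath {V : Type*} (H : SimpleGraph V) (r : ℕ) where
  order : ℕ
  copy : SimpleGraph.Copy ((SimpleGraph.pathGraph order).power r) H

/-- The `r`-path `P` connects `K` and `K'`: its first `r` vertices, in order, are `K`,
and its last `r` vertices, in order, are `K'`. -/
def PowerPath.Connects {V : Type*} {H : SimpleGraph V} {r : ℕ} (P : PowerPath H r)
    (K K' : Fin r → V) : Prop :=
  ∃ h : r ≤ P.order,
    (∀ i : Fin r, P.copy ⟨i, lt_of_lt_of_le i.isLt h⟩ = K i) ∧
    (∀ i : Fin r, P.copy ⟨P.order - r + i, by have := i.isLt; omega⟩ = K' i)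

/-- The internal vertices of an `r`-path `P` that connects `K` and `K'`: the vertices of `P`
that belong neither to `K` nor to `K'`. -/
def PowerPath.internalVertices {V : Type*} {H : SimpleGraph V} {r : ℕ} (P : PowerPath H r)
    (K K' : Fin r → V) : Set V :=
  Set.range P.copy \ (Set.range K ∪ Set.range K')

/-! Put r = k + 1 and let d bound the number of non-neighbours of a vertex in G. The degree
condition says that any r vertices have linearly many common neighbours, even outside Z, K and K'. A
connecting r-path needs edges between vertices at distance less than r, edges between the ends and
the interior, and edges between interior vertices at distance exactly r. The first two kinds come
from G, and the last kind from the random graph.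

Deterministic part (`density_walk`, `density_tupleConnects`): a constant proportion c of all tuples
of (k+1)2^(k+1) vertices supply every edge required of G, with c independent of n and of the
cliques. The interior is cut into 2^(k+1) blocks of r vertices. The count is by induction on the
block size: inside the neighbourhood of a vertex z, blocks with one vertex less can be linked, and
each of them is then extended by its own copy of z.

Random part (`binomialRandom_braid`): the missing edges form r disjoint paths i, i + r, i + 2r, ...
of indices. G(n,p) is exposed in rounds. Each round realises the edge at the first index and deletes
that index, and the family of remaining tuples stays dense. With C large the failure probability is
at most a constant times exp(-Ln), for any prescribed L. This beats the union bound over all K, K'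
and Z, which number at most exp((2r + 1)n). -/

/-! ### Density of predicates on finite types. -/

/-- The predicate `P` holds on at least a `c`-fraction of the finite type `Ω`. -/
def HasDensity {Ω : Type*} [Fintype Ω] (c : ℝ) (P : Ω → Prop) : Prop :=
  c * (Fintype.card Ω : ℝ) ≤ (Nat.card {ω // P ω} : ℝ)

namespace HasDensity

variable {Ω Ω' : Type*} [Fintype Ω] [Fintype Ω'] {a b c : ℝ}

theorem mono {P Q : Ω → Prop} (h : HasDensity c P) (hPQ : ∀ ω, P ω → Q ω) : HasDensity c Q := by
  refine h.trans ?_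
  exact_mod_cast Nat.card_le_card_of_injective
    (fun ω : {ω // P ω} => (⟨ω.1, hPQ _ ω.2⟩ : {ω // Q ω}))
    (fun x y h => by simpa [Subtype.ext_iff] using h)

theorem mono_left {P : Ω → Prop} (h : HasDensity c P) (hbc : b ≤ c) : HasDensity b P :=
  (mul_le_mul_of_nonneg_right hbc (Nat.cast_nonneg _)).trans h

theorem of_equiv {P : Ω' → Prop} (e : Ω ≃ Ω') (h : HasDensity c (fun ω => P (e ω))) :
    HasDensity c P := by
  unfold HasDensity at *
  rw [← Fintype.card_congr e, ← Nat.card_congr (e.subtypeEquiv (p := fun ω => P (e ω))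
    (fun _ => Iff.rfl))]
  exact h

theorem exists_of_pos {P : Ω → Prop} [Nonempty Ω] (hc : 0 < c) (h : HasDensity c P) :
    ∃ ω, P ω := by
  by_contra! hP
  unfold HasDensity at h
  have : IsEmpty {ω // P ω} := ⟨fun ω => hP _ ω.2⟩
  have h1 : (0 : ℝ) < Fintype.card Ω := by exact_mod_cast Fintype.card_pos
  simp only [Nat.card_of_isEmpty, Nat.cast_zero] at h
  nlinarith [mul_pos hc h1]

theorem card_prod_eq_sum (R : Ω × Ω' → Prop) :
    Nat.card {x // R x} = ∑ ω, Nat.card {η // R (ω, η)} := by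
  classical
  rw [← Nat.card_sigma]
  exact Nat.card_congr
    { toFun := fun x => ⟨x.1.1, x.1.2, x.2⟩
      invFun := fun x => ⟨(x.1, x.2.1), x.2.2⟩
      left_inv := fun _ => rfl
      right_inv := fun _ => rfl }

theorem card_subtype_le (P : Ω → Prop) : Nat.card {ω // P ω} ≤ Fintype.card Ω := by
  rw [← Nat.card_eq_fintype_card]
  exact Nat.card_le_card_of_injective _ Subtype.val_injective

theorem card_eq_sum_ite (P : Ω → Prop) [DecidablePred P] :
    (Nat.card {ω // P ω} : ℝ) = ∑ ω, if P ω then (1 : ℝ) else 0 := by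
  rw [Nat.card_eq_fintype_card, Fintype.card_subtype]
  simp

/-- This is the rule for greedy choices: objects picked one after another, each with a dense set of
options given the earlier ones, form a family whose density is the product. -/
theorem and_prod {P : Ω → Prop} {Q : Ω → Ω' → Prop} (hb : 0 ≤ b) (hP : HasDensity a P)
    (hQ : ∀ ω, P ω → HasDensity b (Q ω)) :
    HasDensity (a * b) (fun x : Ω × Ω' => P x.1 ∧ Q x.1 x.2) := by
  classical
  unfold HasDensity at *
  rw [card_prod_eq_sum, Fintype.card_prod]
  push_cast
  have key : ∀ ω, (if P ω then (1 : ℝ) else 0) * (b * Fintype.card Ω') ≤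
      (Nat.card {η // P ω ∧ Q ω η} : ℝ) := by
    intro ω
    split_ifs with h
    · simpa [h] using hQ ω h
    · simp
  calc a * b * (Fintype.card Ω * Fintype.card Ω' : ℝ)
      = (a * Fintype.card Ω) * (b * Fintype.card Ω') := by ring
    _ ≤ Nat.card {ω // P ω} * (b * Fintype.card Ω') := by gcongr
    _ = ∑ ω, (if P ω then (1 : ℝ) else 0) * (b * Fintype.card Ω') := by
        rw [card_eq_sum_ite, Finset.sum_mul]
    _ ≤ _ := Finset.sum_le_sum fun ω _ => key ω

/-- A dense bipartite relation contains many stars: Jensen's inequality. -/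
theorem pow {R : Ω × Ω' → Prop} (hc : 0 ≤ c) (hR : HasDensity c R) (g : ℕ) :
    HasDensity (c ^ (g + 1)) (fun x : Ω × (Fin (g + 1) → Ω') => ∀ j, R (x.1, x.2 j)) := by
  classical
  unfold HasDensity at *
  rw [card_prod_eq_sum] at hR ⊢
  have h1 : ∀ ω, Nat.card {η : Fin (g + 1) → Ω' // ∀ j, R (ω, η j)} =
      Nat.card {η // R (ω, η)} ^ (g + 1) := by
    intro ω
    rw [Nat.card_congr (Equiv.subtypePiEquivPi (p := fun _ η => R (ω, η))), Nat.card_pi]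
    simp
  simp only [h1]
  push_cast
  rw [Fintype.card_prod] at hR ⊢
  push_cast at hR ⊢
  rcases isEmpty_or_nonempty Ω with hΩ | hΩ
  · simp
  have hpos : (0 : ℝ) < Fintype.card Ω := by exact_mod_cast Fintype.card_pos
  have := pow_sum_div_card_le_sum_pow (s := (Finset.univ : Finset Ω))
    (f := fun ω => (Nat.card {η // R (ω, η)} : ℝ)) (fun _ _ => by positivity) g
  refine le_trans ?_ this
  rw [le_div_iff₀ (by simpa using pow_pos hpos g)]
  calc _ = (c * (Fintype.card Ω * Fintype.card Ω')) ^ (g + 1) := by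
        simp [Finset.card_univ]; ring
    _ ≤ _ := by gcongr

/-- Averaging: fibres of density below c/2 contribute at most half of `R`, and every other fibre
contributes at most a full copy of Ω'. -/
theorem slices [Nonempty Ω'] {R : Ω × Ω' → Prop} (hc : 0 ≤ c) (hR : HasDensity c R) :
    HasDensity (c / 2) (fun ω => HasDensity (c / 2) (fun η => R (ω, η))) := by
  classical
  unfold HasDensity at hR ⊢
  rw [card_prod_eq_sum, Fintype.card_prod] at hR
  push_cast at hR
  rw [card_eq_sum_ite]
  set S := fun ω => c / 2 * (Fintype.card Ω' : ℝ) ≤ (Nat.card {η // R (ω, η)} : ℝ) with hS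
  have hle : ∀ ω, (Nat.card {η // R (ω, η)} : ℝ) ≤
      (if S ω then (1 : ℝ) else 0) * Fintype.card Ω' + c / 2 * Fintype.card Ω' := by
    intro ω
    split_ifs with h
    · have : (Nat.card {η // R (ω, η)} : ℝ) ≤ Fintype.card Ω' := by
        exact_mod_cast card_subtype_le _
      have : 0 ≤ c / 2 * (Fintype.card Ω' : ℝ) := by positivity
      linarith
    · simp only [hS, not_le] at h
      linarith
  have hsum := hR.trans (Finset.sum_le_sum fun ω _ => hle ω)
  rw [Finset.sum_add_distrib, ← Finset.sum_mul] at hsum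
  simp only [Finset.sum_const, Finset.card_univ, nsmul_eq_mul] at hsum
  have hpos : (0 : ℝ) < Fintype.card Ω' := by exact_mod_cast Fintype.card_pos
  refine le_of_mul_le_mul_right ?_ hpos
  linarith

end HasDensity

theorem HasDensity.of_forall {Ω : Type*} [Fintype Ω] {P : Ω → Prop} (h : ∀ ω, P ω) :
    HasDensity 1 P := by
  unfold HasDensity
  rw [Nat.card_congr (Equiv.subtypeUnivEquiv h), Nat.card_eq_fintype_card, one_mul]

theorem HasDensity.of_le_card {V : Type*} [Fintype V] {γ : ℝ} {S : Finset V}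
    (h : γ * Fintype.card V ≤ S.card) : HasDensity γ (fun v => v ∈ S) := by
  classical
  unfold HasDensity
  rwa [Nat.card_eq_fintype_card, Fintype.card_coe]

/-! ### Clique blocks and walks of blocks. -/

/-- The entries of `K` are pairwise adjacent. -/
def IsCliqueTuple {V : Type*} (G : SimpleGraph V) {r : ℕ} (K : Fin r → V) : Prop :=
  ∀ i j, i ≠ j → G.Adj (K i) (K j)

/-- The adjacencies required between two consecutive blocks of `r` vertices of a copy of the
`(r - 1)`-st power of a path. -/
def Step {V : Type*} (G : SimpleGraph V) {r : ℕ} (K L : Fin r → V) : Prop :=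
  ∀ i j, j < i → G.Adj (K i) (L j)

theorem IsCliqueTuple.cons {V : Type*} {G : SimpleGraph V} {r : ℕ} {K : Fin r → V} {v : V}
    (hK : IsCliqueTuple G K) (hv : ∀ i, G.Adj v (K i)) :
    IsCliqueTuple G (Fin.cons v K : Fin (r + 1) → V) := by
  intro i j hij
  induction i using Fin.cases with
  | zero =>
    induction j using Fin.cases with
    | zero => exact absurd rfl hij
    | succ j => simpa using hv j
  | succ i =>
    induction j using Fin.cases with
    | zero => simpa using (hv i).symm
    | succ j => simpa using hK i j (fun h => hij (by rw [h]))

theorem Step.cons {V : Type*} {G : SimpleGraph V} {r : ℕ} {K L : Fin r → V} {u v : V}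
    (h : Step G K L) (hv : ∀ i, G.Adj (K i) v) :
    Step G (Fin.cons u K : Fin (r + 1) → V) (Fin.cons v L : Fin (r + 1) → V) := by
  intro i j hij
  induction i using Fin.cases with
  | zero => exact absurd hij (Fin.not_lt_zero j)
  | succ i =>
    induction j using Fin.cases with
    | zero => simpa using hv i
    | succ j => simpa using h i j (Fin.succ_lt_succ_iff.1 hij)

/-- A sequence of ordered cliques, each one a step after the previous one, the first one
being a step after `x`. -/
structure IsWalk {V : Type*} (G : SimpleGraph V) {r m : ℕ} (x : Fin r → V)
    (W : Fin m → Fin r → V) : Prop where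
  first : ∀ a : Fin m, (a : ℕ) = 0 → Step G x (W a)
  step : ∀ a b : Fin m, (a : ℕ) + 1 = b → Step G (W a) (W b)
  clique : ∀ a, IsCliqueTuple G (W a)

theorem IsWalk.snoc {V : Type*} {G : SimpleGraph V} {r m : ℕ} {x y : Fin r → V}
    {W : Fin m → Fin r → V} (hW : IsWalk G x W) (hy : IsCliqueTuple G y)
    (h0 : m = 0 → Step G x y) (hlast : ∀ a : Fin m, (a : ℕ) + 1 = m → Step G (W a) y) :
    IsWalk G x (Fin.snoc W y : Fin (m + 1) → Fin r → V) where
  first a ha := by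
    induction a using Fin.lastCases with
    | last => simpa using h0 (by simpa using ha)
    | cast a => simpa using hW.first a (by simpa using ha)
  step a b hab := by
    induction b using Fin.lastCases with
    | last =>
      induction a using Fin.lastCases with
      | last => simp at hab
      | cast a => simpa using hlast a (by simpa using hab)
    | cast b =>
      induction a using Fin.lastCases with
      | last =>
        simp only [Fin.val_last, Fin.val_castSucc] at hab
        omega
      | cast a => simpa using hW.step a b (by simpa using hab)
  clique a := by
    induction a using Fin.lastCases with
    | last => simpa using hy
    | cast a => simpa using hW.clique a

theorem IsWalk.append {V : Type*} {G : SimpleGraph V} {r m m' : ℕ} {x : Fin r → V}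
    {W : Fin m → Fin r → V} {W' : Fin m' → Fin r → V} (hm : 0 < m)
    (hW : IsWalk G x W) (hW' : IsWalk G (W ⟨m - 1, by omega⟩) W') :
    IsWalk G x (Fin.append W W') where
  first a ha := by
    induction a using Fin.addCases with
    | left a => simpa using hW.first a (by simpa using ha)
    | right a =>
      simp only [Fin.val_natAdd] at ha
      omega
  step a b hab := by
    induction a using Fin.addCases with
    | left a =>
      induction b using Fin.addCases with
      | left b => simpa using hW.step a b (by simpa using hab)
      | right b =>
        simp only [Fin.val_castAdd, Fin.val_natAdd] at hab
        have ha : (⟨m - 1, by omega⟩ : Fin m) = a := Fin.ext (by simp only; omega)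
        rw [ha] at hW'
        simpa using hW'.first b (by omega)
    | right a =>
      induction b using Fin.addCases with
      | left b =>
        simp only [Fin.val_castAdd, Fin.val_natAdd] at hab
        omega
      | right b =>
        simp only [Fin.val_natAdd] at hab
        simpa using hW'.step a b (by omega)
  clique a := by
    induction a using Fin.addCases with
    | left a => simpa using hW.clique a
    | right a => simpa using hW'.clique a

/-- Blocks are widened by a new first column. A step never uses column 0 of its source block, so
consecutive new vertices need not be adjacent and only `Fin.tail x` matters. -/
theorem IsWalk.cons {V : Type*} {G : SimpleGraph V} {r m : ℕ} {x : Fin (r + 1) → V}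
    {W : Fin m → Fin r → V} {z : Fin m → V} (hW : IsWalk G (Fin.tail x) W)
    (hx : ∀ a i, G.Adj (z a) (Fin.tail x i)) (hz : ∀ a b i, G.Adj (z a) (W b i)) :
    IsWalk G x (fun a => (Fin.cons (z a) (W a) : Fin (r + 1) → V)) where
  first a ha := by
    have := (hW.first a ha).cons (u := x 0) (v := z a) fun i => (hx a i).symm
    rwa [Fin.cons_self_tail] at this
  step a b hab := (hW.step a b hab).cons fun i => (hz _ _ _).symm
  clique a := (hW.clique a).cons fun i => hz _ _ _

/-! ### Greedy choices when every vertex has at most d non-neighbours. -/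

section MinDegree

variable {V : Type*} [Fintype V] {G : SimpleGraph V} {d : ℕ}

-- Each prescribed neighbour excludes at most d elements of `U`; all later size estimates count such
-- constraints.
open Classical in
theorem card_le_of_common_nbrs
    (hd : ∀ v, (Finset.univ.filter fun u => ¬ G.Adj v u).card ≤ d)
    (U A : Finset V) {ι : Type*} (I : Finset ι) (x : ι → V)
    (hA : ∀ u ∈ U, (∀ i ∈ I, G.Adj (x i) u) → u ∈ A) :
    U.card ≤ A.card + I.card * d := by
  have hsub : U ⊆ A ∪ I.biUnion fun i => Finset.univ.filter fun u => ¬ G.Adj (x i) u := by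
    intro u hu
    by_cases h : ∀ i ∈ I, G.Adj (x i) u
    · exact Finset.mem_union_left _ (hA u hu h)
    · simp only [Finset.mem_union, Finset.mem_biUnion, Finset.mem_filter, Finset.mem_univ, true_and]
      push Not at h
      exact Or.inr h
  refine (Finset.card_le_card hsub).trans ((Finset.card_union_le _ _).trans
    (Nat.add_le_add_left ?_ _))
  exact Finset.card_biUnion_le_card_mul _ _ _ fun i _ => hd _

open Classical in
theorem card_filter_adj_one (hd : ∀ v, (Finset.univ.filter fun u => ¬ G.Adj v u).card ≤ d)
    (U : Finset V) (v : V) : (U.card : ℝ) - d ≤ (U.filter fun u => G.Adj v u).card := by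
  have := card_le_of_common_nbrs hd U (U.filter fun u => G.Adj v u) (Finset.univ : Finset Unit)
    (fun _ => v) (by simp +contextual)
  simp only [Finset.card_univ, Fintype.card_unit, one_mul] at this
  have h : (U.card : ℝ) ≤ (U.filter fun u => G.Adj v u).card + d := by exact_mod_cast this
  linarith

open Classical in
/-- Ordered cliques whose entries are chosen from large enough sets, greedily from the left. -/
theorem density_cliqueTuple (hd : ∀ v, (Finset.univ.filter fun u => ¬ G.Adj v u).card ≤ d)
    {γ : ℝ} (hγ : 0 ≤ γ) (m : ℕ) (S : Fin m → Finset V)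
    (hS : ∀ i : Fin m, γ * Fintype.card V + (i : ℕ) * d ≤ (S i).card) :
    HasDensity (γ ^ m) (fun v : Fin m → V => (∀ i, v i ∈ S i) ∧ IsCliqueTuple G v) := by
  induction m with
  | zero => exact HasDensity.of_forall fun v => ⟨fun i => i.elim0, fun i => i.elim0⟩
  | succ m ih =>
    have h0 : HasDensity γ (fun v => v ∈ S 0) := HasDensity.of_le_card (by simpa using hS 0)
    have h1 : ∀ v, v ∈ S 0 → HasDensity (γ ^ m) (fun f : Fin m → V =>
        (∀ i, f i ∈ (S i.succ).filter fun u => G.Adj v u) ∧ IsCliqueTuple G f) := by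
      intro v _
      refine ih _ fun i => ?_
      have h2 := card_filter_adj_one hd (S i.succ) v
      have h3 := hS i.succ
      simp only [Fin.val_succ] at h3
      push_cast at h3
      linarith
    refine HasDensity.of_equiv (Fin.consEquiv fun _ => V) (((h0.and_prod (by positivity)
      h1).mono_left (by rw [pow_succ'])).mono ?_)
    rintro ⟨v, f⟩ ⟨hv, hf, hcl⟩
    simp only [Finset.mem_filter] at hf hv
    refine ⟨fun i => ?_, hcl.cons fun i => (hf i).2⟩
    induction i using Fin.cases with
    | zero => exact hv
    | succ i => exact (hf i).1

open Classical in
/-- Ordered cliques whose entries are chosen from large enough sets, greedily from the right. -/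
theorem density_cliqueTuple_rev (hd : ∀ v, (Finset.univ.filter fun u => ¬ G.Adj v u).card ≤ d)
    {γ : ℝ} (hγ : 0 ≤ γ) (m : ℕ) (S : Fin m → Finset V)
    (hS : ∀ i : Fin m, γ * Fintype.card V + (m - 1 - i : ℝ) * d ≤ (S i).card) :
    HasDensity (γ ^ m) (fun v : Fin m → V => (∀ i, v i ∈ S i) ∧ IsCliqueTuple G v) := by
  refine HasDensity.of_equiv (Equiv.arrowCongr Fin.revPerm (Equiv.refl V))
    ((density_cliqueTuple hd hγ m (fun i => S i.rev) fun i => ?_).mono ?_)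
  · refine le_trans (le_of_eq ?_) (hS i.rev)
    rw [Fin.val_rev, Nat.cast_sub (by omega)]
    push_cast
    ring
  · rintro v ⟨h1, h2⟩
    refine ⟨fun i => ?_, fun i j hij => ?_⟩
    · have := h1 i.rev
      rw [Fin.rev_rev] at this
      exact this
    · exact h2 _ _ fun h => hij (Fin.rev_injective h)

end MinDegree

/-! ### Counting walks of blocks by induction on the block size. -/

/-- The number of blocks strictly between the two ends of a walk of blocks of `s + 1` vertices. -/
def walkLength : ℕ → ℕ
  | 0 => 0
  | s + 1 => (walkLength s + 1) + (walkLength s + 1)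

theorem walkLength_add_two (s : ℕ) : walkLength s + 2 = 2 ^ (s + 1) := by
  induction s with
  | zero => rfl
  | succ s ih =>
    rw [walkLength, pow_succ, ← ih]
    ring

/-- Assembling the blocks of a walk from the blocks of two walks with one vertex less in each
block. -/
def glueEquiv (V : Type*) (s m : ℕ) :
    ((Fin (m + 1) → V) × ((Fin s → V) × (Fin m → Fin s → V))) ×
      ((Fin (m + 1) → V) × ((Fin s → V) × (Fin m → Fin s → V))) ≃
    (Fin ((m + 1) + (m + 1)) → Fin (s + 1) → V) :=
  let e : ((Fin (m + 1) → V) × ((Fin s → V) × (Fin m → Fin s → V))) ≃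
      (Fin (m + 1) → Fin (s + 1) → V) :=
    ((Equiv.refl _).prodCongr (Fin.snocEquiv fun _ => Fin s → V)).trans
      ((Equiv.arrowProdEquivProdArrow _ _ _).symm.trans
        (Equiv.piCongrRight fun _ => Fin.consEquiv fun _ => V))
  (e.prodCongr e).trans (Fin.appendEquiv _ _)

theorem glueEquiv_apply {V : Type*} {s m : ℕ} (z z' : Fin (m + 1) → V) (q q' : Fin s → V)
    (w w' : Fin m → Fin s → V) :
    glueEquiv V s m ((z, (q, w)), (z', (q', w'))) =
      Fin.append (fun a => Fin.cons (z a) ((Fin.snoc w q : Fin (m + 1) → Fin s → V) a))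
        (fun a => Fin.cons (z' a) ((Fin.snoc w' q' : Fin (m + 1) → Fin s → V) a)) :=
  rfl

-- The walk has two halves with a middle tuple q and a final tuple y'. In the first half, a walk
-- from `Fin.tail x` to q lies in the neighbourhood of z; in the second, a walk from q to y' lies in
-- the neighbourhood of z'. Restricting `U` to the neighbours of one vertex costs d, exactly the
-- slack needed for the induction hypothesis. Finally z and z' are replaced by many copies, since
-- the vertices of different blocks must eventually be distinct.
open Classical in
theorem density_walk_succ {s m : ℕ} {γ c : ℝ} (hγ : 0 < γ) (hc : 0 < c) {V : Type*} [Fintype V]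
    {G : SimpleGraph V} {d : ℕ} (hd : ∀ v, (Finset.univ.filter fun u => ¬ G.Adj v u).card ≤ d)
    (ih : ∀ (U : Finset V) (x y : Fin (s + 1) → V), IsCliqueTuple G y →
      γ * Fintype.card V + (s + 1) * d ≤ U.card →
      HasDensity c (fun B : Fin m → Fin (s + 1) → V => (∀ a i, B a i ∈ U) ∧
        IsWalk G x (Fin.snoc B y : Fin (m + 1) → Fin (s + 1) → V)))
    (U : Finset V) (x y : Fin (s + 2) → V) (hy : IsCliqueTuple G y)
    (hU : γ * Fintype.card V + (s + 2) * d ≤ U.card) :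
    HasDensity (((γ ^ (s + 1) * γ * γ * γ ^ (s + 1) * c * c) ^ (m + 1)) ^ (m + 1))
      (fun B : Fin ((m + 1) + (m + 1)) → Fin (s + 2) → V => (∀ a i, B a i ∈ U) ∧
        IsWalk G x (Fin.snoc B y : Fin ((m + 1) + (m + 1) + 1) → Fin (s + 2) → V)) := by
  have hd0 : (0 : ℝ) ≤ d := Nat.cast_nonneg d
  have hsd : (0 : ℝ) ≤ s * d := by positivity
  obtain ⟨N₁, hN₁⟩ : ∃ N₁ : V → Finset V, ∀ v, N₁ v = U.filter fun u => G.Adj v u :=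
    ⟨_, fun _ => rfl⟩
  have hN₁card : ∀ v, (U.card : ℝ) - d ≤ (N₁ v).card := fun v => by
    rw [hN₁]; exact card_filter_adj_one hd U v
  -- Entry i of y' becomes entry i + 1 of the last block, so the step to y demands adjacency to y j
  -- for all j ≤ i. Later entries meet more of these constraints, so y' is chosen from the right.
  obtain ⟨S, hS⟩ : ∃ S : Fin (s + 1) → Finset V, ∀ i, S i =
      U.filter fun u => ∀ j ∈ Finset.Iic i.castSucc, G.Adj (y j) u := ⟨_, fun _ => rfl⟩
  have hScard : ∀ i : Fin (s + 1),
      γ * Fintype.card V + ((s + 1 : ℕ) - 1 - i : ℝ) * d ≤ (S i).card := by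
    intro i
    have h1 := card_le_of_common_nbrs hd U (S i) (Finset.Iic i.castSucc) y
      fun u hu h => by rw [hS]; exact Finset.mem_filter.2 ⟨hu, h⟩
    rw [Fin.card_Iic, Fin.val_castSucc] at h1
    have h2 : (U.card : ℝ) ≤ (S i).card + (i + 1) * d := by exact_mod_cast h1
    push_cast
    linarith
  obtain ⟨N, hN⟩ : ∃ N : (Fin (s + 1) → V) → Finset V, ∀ q, N q =
      U.filter fun u => ∀ i ∈ Finset.univ, G.Adj (q i) u := ⟨_, fun _ => rfl⟩
  have hNcard : ∀ q, γ * Fintype.card V ≤ (N q).card := by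
    intro q
    have h1 := card_le_of_common_nbrs hd U (N q) Finset.univ q
      fun u hu h => by rw [hN]; exact Finset.mem_filter.2 ⟨hu, h⟩
    rw [Finset.card_univ, Fintype.card_fin] at h1
    have h2 : (U.card : ℝ) ≤ (N q).card + (s + 1) * d := by exact_mod_cast h1
    linarith
  let T := Fin (s + 1) → V
  let A := Fin m → Fin (s + 1) → V
  have h1 := density_cliqueTuple_rev hd hγ.le (s + 1) S hScard
  have h2 := h1.and_prod (Q := fun (y' : T) z' => z' ∈ N y') hγ.le
    fun y' _ => HasDensity.of_le_card (hNcard y')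
  have h3 := h2.and_prod (Q := fun (_ : T × V) z => z ∈ N (Fin.tail x)) hγ.le
    fun _ _ => HasDensity.of_le_card (hNcard _)
  -- The tuple q ends the first half and starts the second, so it lies in both neighbourhoods. This
  -- costs 2d, and at most s further constraints come from the clique condition.
  have h4 := h3.and_prod (Q := fun (ω : (T × V) × V) (q : T) =>
      (∀ i, q i ∈ (N₁ ω.2).filter fun u => G.Adj ω.1.2 u) ∧
        IsCliqueTuple G q) (by positivity) fun ω _ => density_cliqueTuple hd hγ.le (s + 1) _
      fun i => by
        have h1 := hN₁card ω.2
        have h2 := card_filter_adj_one hd (N₁ ω.2) ω.1.2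
        have h3 : (i : ℝ) * d ≤ s * d := by
          gcongr
          exact_mod_cast Nat.le_of_lt_succ i.2
        linarith
  have h5 := h4.and_prod (Q := fun (ω : ((T × V) × V) × T) (w : A) =>
      (∀ a i, w a i ∈ N₁ ω.1.2) ∧
        IsWalk G (Fin.tail x) (Fin.snoc w ω.2 : Fin (m + 1) → T)) hc.le
      fun ω hω => ih (N₁ ω.1.2) (Fin.tail x) ω.2 hω.2.2 (by linarith [hN₁card ω.1.2])
  have h6 := h5.and_prod (Q := fun (ω : (((T × V) × V) × T) × A) (w : A) =>
      (∀ a i, w a i ∈ N₁ ω.1.1.1.2) ∧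
        IsWalk G ω.1.2 (Fin.snoc w ω.1.1.1.1 : Fin (m + 1) → T)) hc.le
      fun ω hω => ih (N₁ ω.1.1.1.2) ω.1.2 ω.1.1.1.1 hω.1.1.1.1.2 (by linarith [hN₁card ω.1.1.1.2])
  let e₁ : ((((T × V) × V) × T) × A) × A ≃ (V × (T × T × A × A)) × V :=
    { toFun := fun ω => ((ω.1.1.1.1.2, ω.1.1.1.1.1, ω.1.1.2, ω.1.2, ω.2), ω.1.1.1.2)
      invFun := fun ω => (((((ω.1.2.1, ω.1.1), ω.2), ω.1.2.2.1), ω.1.2.2.2.1), ω.1.2.2.2.2)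
      left_inv := fun _ => rfl
      right_inv := fun _ => rfl }
  let P : T → V → V → T → A → A → Prop := fun y' z' z q w w' =>
    (((((∀ i, y' i ∈ S i) ∧ IsCliqueTuple G y') ∧ z' ∈ N y') ∧ z ∈ N (Fin.tail x)) ∧
      ((∀ i, q i ∈ (N₁ z).filter fun u => G.Adj z' u) ∧ IsCliqueTuple G q)) ∧
      ((∀ a i, w a i ∈ N₁ z) ∧ IsWalk G (Fin.tail x) (Fin.snoc w q : Fin (m + 1) → T)) ∧
      ((∀ a i, w' a i ∈ N₁ z') ∧ IsWalk G q (Fin.snoc w' y' : Fin (m + 1) → T))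
  have h7 : HasDensity (γ ^ (s + 1) * γ * γ * γ ^ (s + 1) * c * c)
      (fun ω : (V × (T × T × A × A)) × V =>
        P ω.1.2.1 ω.1.1 ω.2 ω.1.2.2.1 ω.1.2.2.2.1 ω.1.2.2.2.2) :=
    HasDensity.of_equiv e₁ (h6.mono fun ω h => ⟨h.1.1, h.1.2, h.2⟩)
  -- With z split off as the last factor, `HasDensity.pow` supplies m + 1 choices of z, one per
  -- block of the first half, compatible with the same remaining data. After `e₂` the same is done
  -- for z'.
  have h8 := h7.pow (by positivity) m
  let e₂ : (V × (T × T × A × A)) × (Fin (m + 1) → V) ≃ ((Fin (m + 1) → V) × (T × T × A × A)) × V :=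
    { toFun := fun ω => ((ω.2, ω.1.2), ω.1.1)
      invFun := fun ω => ((ω.2, ω.1.2), ω.1.1)
      left_inv := fun _ => rfl
      right_inv := fun _ => rfl }
  have h9 : HasDensity ((γ ^ (s + 1) * γ * γ * γ ^ (s + 1) * c * c) ^ (m + 1))
      (fun ω : ((Fin (m + 1) → V) × (T × T × A × A)) × V =>
        ∀ j, P ω.1.2.1 ω.2 (ω.1.1 j) ω.1.2.2.1 ω.1.2.2.2.1 ω.1.2.2.2.2) :=
    HasDensity.of_equiv e₂ h8
  have h10 := h9.pow (by positivity) m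
  let e₃ : ((Fin (m + 1) → V) × (T × T × A × A)) × (Fin (m + 1) → V) ≃
      ((Fin (m + 1) → V) × (T × A)) × ((Fin (m + 1) → V) × (T × A)) :=
    { toFun := fun ω => ((ω.1.1, (ω.1.2.2.1, ω.1.2.2.2.1)), (ω.2, (ω.1.2.1, ω.1.2.2.2.2)))
      invFun := fun ω => ((ω.1.1, (ω.2.2.1, ω.1.2.1, ω.1.2.2, ω.2.2.2)), ω.2.1)
      left_inv := fun _ => rfl
      right_inv := fun _ => rfl }
  refine HasDensity.of_equiv (e₃.trans (glueEquiv V (s + 1) m)) (h10.mono ?_)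
  rintro ⟨⟨z, y', q, w, w'⟩, z'⟩ h
  change ∀ j' j, P y' (z' j') (z j) q w w' at h
  change (∀ a i, glueEquiv V (s + 1) m ((z, (q, w)), (z', (y', w'))) a i ∈ U) ∧
    IsWalk G x (Fin.snoc (glueEquiv V (s + 1) m ((z, (q, w)), (z', (y', w')))) y :
      Fin ((m + 1) + (m + 1) + 1) → Fin (s + 2) → V)
  rw [glueEquiv_apply]
  simp only [P, hN₁, hN, hS, Finset.mem_filter, Finset.mem_univ, forall_const] at h
  obtain ⟨⟨⟨⟨⟨hy', hy'c⟩, -⟩, -⟩, -, hqc⟩, ⟨-, hw⟩, -, hw'⟩ := h 0 0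
  have hzx : ∀ a i, G.Adj (z a) (Fin.tail x i) := fun a i => ((h 0 a).1.1.2.2 i).symm
  have hzq : ∀ a i, G.Adj (z a) (q i) := fun a i => ((h 0 a).1.2.1 i).1.2
  have hzw : ∀ a b i, G.Adj (z a) (w b i) := fun a b i => ((h 0 a).2.1.1 b i).2
  have hz'q : ∀ a i, G.Adj (z' a) (q i) := fun a i => ((h a 0).1.2.1 i).2
  have hz'y : ∀ a i, G.Adj (z' a) (y' i) := fun a i => ((h a 0).1.1.1.2.2 i).symm
  have hz'w : ∀ a b i, G.Adj (z' a) (w' b i) := fun a b i => ((h a 0).2.2.1 b i).2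
  constructor
  · intro a
    induction a using Fin.addCases with
    | left a =>
      intro i
      rw [Fin.append_left]
      induction i using Fin.cases with
      | zero => exact (h 0 a).1.1.2.1
      | succ i =>
        induction a using Fin.lastCases with
        | last => simpa using ((h 0 0).1.2.1 i).1.1
        | cast a => simpa using ((h 0 0).2.1.1 a i).1
    | right a =>
      intro i
      rw [Fin.append_right]
      induction i using Fin.cases with
      | zero => exact (h a 0).1.1.1.2.1
      | succ i =>
        induction a using Fin.lastCases with
        | last => simpa using (hy' i).1
        | cast a => simpa using ((h 0 0).2.2.1 a i).1
  · have hW₁ : IsWalk G x (fun a => (Fin.cons (z a) ((Fin.snoc w q : Fin (m + 1) → T) a) :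
        Fin (s + 2) → V)) := by
      refine hw.cons hzx fun a b i => ?_
      induction b using Fin.lastCases with
      | last => simpa using hzq a i
      | cast b => simpa using hzw a b i
    have hlast : Fin.tail ((fun a => (Fin.cons (z a) ((Fin.snoc w q : Fin (m + 1) → T) a) :
        Fin (s + 2) → V)) ⟨m + 1 - 1, by omega⟩) = q := by
      have : (⟨m + 1 - 1, by omega⟩ : Fin (m + 1)) = Fin.last m := rfl
      rw [this]
      simp
    have hW₂ : IsWalk G ((fun a => (Fin.cons (z a) ((Fin.snoc w q : Fin (m + 1) → T) a) :
        Fin (s + 2) → V)) ⟨m + 1 - 1, by omega⟩)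
        (fun a => (Fin.cons (z' a) ((Fin.snoc w' y' : Fin (m + 1) → T) a) :
        Fin (s + 2) → V)) := by
      refine IsWalk.cons (by rw [hlast]; exact hw') (by rw [hlast]; exact hz'q) fun a b i => ?_
      induction b using Fin.lastCases with
      | last => simpa using hz'y a i
      | cast b => simpa using hz'w a b i
    refine (hW₁.append (Nat.succ_pos m) hW₂).snoc hy (by omega) fun a ha => ?_
    have : a = Fin.natAdd (m + 1) (Fin.last m) :=
      Fin.ext (by simp only [Fin.val_natAdd, Fin.val_last]; omega)
    rw [this, Fin.append_right, Fin.snoc_last]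
    intro i j hij
    induction i using Fin.cases with
    | zero => exact absurd hij (Fin.not_lt_zero j)
    | succ i =>
      rw [Fin.cons_succ]
      refine ((hy' i).2 j ?_).symm
      rw [Finset.mem_Iic]
      exact Fin.le_castSucc_iff.2 hij

open Classical in
/-- In a graph of large minimum degree, there are many walks of a fixed length between any two
tuples. -/
theorem density_walk (s : ℕ) (γ : ℝ) (hγ : 0 < γ) :
    ∃ c : ℝ, 0 < c ∧ ∀ (V : Type) [Fintype V] (G : SimpleGraph V) (d : ℕ),
      (∀ v, (Finset.univ.filter fun u => ¬ G.Adj v u).card ≤ d) →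
      ∀ (U : Finset V) (x y : Fin (s + 1) → V), IsCliqueTuple G y →
      γ * Fintype.card V + (s + 1) * d ≤ U.card →
      HasDensity c (fun B : Fin (walkLength s) → Fin (s + 1) → V =>
        (∀ a i, B a i ∈ U) ∧
          IsWalk G x (Fin.snoc B y : Fin (walkLength s + 1) → Fin (s + 1) → V)) := by
  induction s with
  | zero =>
    refine ⟨1, one_pos, fun V _ G d hd U x y hy hU => HasDensity.of_forall fun B =>
      ⟨fun a => a.elim0, IsWalk.snoc ⟨fun a => a.elim0, fun a => a.elim0, fun a => a.elim0⟩ hy ?_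
        fun a => a.elim0⟩⟩
    intro _ i j hij
    omega
  | succ s ih =>
    obtain ⟨c, hc, ih⟩ := ih
    refine ⟨_, ?_, fun V _ G d hd U x y hy hU =>
      density_walk_succ hγ hc hd (ih V G d hd) U x y hy (by push_cast at hU; linarith)⟩
    positivity

/-! ### Random graphs: exposure in rounds and dense families. -/

section

open MeasureTheory ProbabilityTheory unitInterval

variable {V : Type*}

theorem binomialRandom_avoid [Countable V] (p : I) (S : Finset (Sym2 V))
    (hS : ∀ e ∈ S, ¬ e.IsDiag) :
    SimpleGraph.binomialRandom V p {Γ | ∀ e ∈ S, e ∉ Γ.edgeSet} =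
      (toNNReal (σ p) : ENNReal) ^ S.card := by
  have hmeas : MeasurableSet {Γ : SimpleGraph V | ∀ e ∈ S, e ∉ Γ.edgeSet} := by
    have : {Γ : SimpleGraph V | ∀ e ∈ S, e ∉ Γ.edgeSet} =
        SimpleGraph.edgeSet ⁻¹' {s | ∀ e ∈ S, e ∉ s} := rfl
    rw [this]
    exact SimpleGraph.measurable_edgeSet (by measurability)
  rw [SimpleGraph.binomialRandom_eq_map, Measure.map_apply SimpleGraph.measurable_fromEdgeSet hmeas,
    setBernoulli_apply']
  have : ((fun p : Sym2 V → Prop => {i | p i}) ⁻¹' (SimpleGraph.fromEdgeSet ⁻¹'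
      {Γ : SimpleGraph V | ∀ e ∈ S, e ∉ Γ.edgeSet})) = Set.pi S (fun _ => {False}) := by
    ext f
    simp only [Set.mem_preimage, Set.mem_ofPred_eq, Set.mem_pi, Finset.mem_coe,
      Set.mem_singleton_iff, SimpleGraph.edgeSet_fromEdgeSet]
    refine forall₂_congr fun e he => ?_
    have := hS e he
    simp [this]
  rw [this, Measure.infinitePi_pi]
  · rw [← Finset.prod_const]
    refine Finset.prod_congr rfl fun e he => ?_
    have := hS e he
    simp [this]
  · intros; measurability

instance discreteMeasurableSpace_simpleGraph [Finite V] :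
    DiscreteMeasurableSpace (SimpleGraph V) where
  forall_measurableSet S := by
    rw [← SimpleGraph.measurableEmbedding_edgeSet.measurableSet_image]
    exact (Set.toFinite _).measurableSet

/-- By induction along the subgraph order, the mass of Γ is that of its lower set minus the masses
of its proper subgraphs. Lower sets are convenient because a union lies below Γ exactly when both
parts do. -/
theorem measure_simpleGraph_ext [Finite V] (μ ν : Measure (SimpleGraph V))
    [IsFiniteMeasure μ] [IsFiniteMeasure ν]
    (h : ∀ Γ, μ (Set.Iic Γ) = ν (Set.Iic Γ)) : μ = ν := by
  classical
  have := Fintype.ofFinite V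
  have := Fintype.ofFinite (SimpleGraph V)
  refine Measure.ext_of_singleton fun Γ => ?_
  induction Γ using WellFoundedLT.induction with
  | ind Γ ih =>
  have key : ∀ μ : Measure (SimpleGraph V),
      μ (Set.Iic Γ) = μ {Γ} + ∑ Γ' with Γ' < Γ, μ {Γ'} := by
    intro μ
    have : Set.Iic Γ = {Γ} ∪ Set.Iio Γ := by simp
    rw [this, measure_union (by simp) .of_discrete]
    congr 1
    have : Set.Iio Γ = ((Finset.univ.filter (· < Γ) : Finset (SimpleGraph V)) : Set _) := by
      ext; simp
    rw [this, sum_measure_singleton]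
  have h1 := h Γ
  rw [key μ, key ν, Finset.sum_congr rfl fun Γ' h => ih Γ' (by simpa using h)] at h1
  refine (ENNReal.add_left_inj ?_).1 h1
  exact (ENNReal.sum_lt_top.2 fun _ _ => measure_lt_top _ _).ne

theorem binomialRandom_Iic [Fintype V] (p : I) (Γ : SimpleGraph V) :
    SimpleGraph.binomialRandom V p (Set.Iic Γ) =
      (toNNReal (σ p) : ENNReal) ^ Γᶜ.edgeSet.ncard := by
  classical
  rw [Set.ncard_eq_toFinset_card', ← binomialRandom_avoid]
  · congr 1
    ext Γ'
    simp only [Set.mem_Iic, Set.mem_toFinset, Set.mem_ofPred_eq]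
    constructor
    · rintro h ⟨u, v⟩ he he'
      exact he.2 (h he')
    · intro h u v huv
      by_contra hn
      exact h s(u, v) ⟨huv.ne, hn⟩ huv
  · intro e he
    exact SimpleGraph.not_isDiag_of_mem_edgeSet _ (by simpa using he)

/-- The union of two independent binomial random graphs is a binomial random graph. -/
theorem binomialRandom_sup [Finite V] {p p₁ p₂ : I} (h : (σ p : ℝ) = σ p₁ * σ p₂) :
    SimpleGraph.binomialRandom V p =
      ((SimpleGraph.binomialRandom V p₁).prod (SimpleGraph.binomialRandom V p₂)).map
        (fun x => x.1 ⊔ x.2) := by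
  have := Fintype.ofFinite V
  have hm : Measurable fun x : SimpleGraph V × SimpleGraph V => x.1 ⊔ x.2 := .of_discrete
  have := Measure.isProbabilityMeasure_map (μ := (SimpleGraph.binomialRandom V p₁).prod
    (SimpleGraph.binomialRandom V p₂)) hm.aemeasurable
  refine measure_simpleGraph_ext _ _ fun Γ => ?_
  rw [Measure.map_apply hm .of_discrete]
  have : (fun x : SimpleGraph V × SimpleGraph V => x.1 ⊔ x.2) ⁻¹' Set.Iic Γ =
    Set.Iic Γ ×ˢ Set.Iic Γ := by ext; simp [Prod.le_def]
  rw [this, Measure.prod_prod, binomialRandom_Iic, binomialRandom_Iic, binomialRandom_Iic,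
    ← mul_pow]
  congr 1
  rw [← ENNReal.coe_mul]
  congr 1
  ext
  simpa using h

/-- Two-round exposure: `B` is the bad event of the first round, and outside it the second round
fails with probability at most `b`. -/
theorem binomialRandom_le_of_sup [Finite V] {p p₁ p₂ : I} (h : (σ p : ℝ) = σ p₁ * σ p₂)
    (A B : Set (SimpleGraph V)) {b : ENNReal}
    (hb : ∀ Γ₁ ∉ B, SimpleGraph.binomialRandom V p₂ {Γ₂ | Γ₁ ⊔ Γ₂ ∈ A} ≤ b) :
    SimpleGraph.binomialRandom V p A ≤ SimpleGraph.binomialRandom V p₁ B + b := by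
  have hm : Measurable fun x : SimpleGraph V × SimpleGraph V => x.1 ⊔ x.2 := .of_discrete
  rw [binomialRandom_sup h, Measure.map_apply hm .of_discrete,
    Measure.prod_apply .of_discrete]
  calc _ ≤ ∫⁻ Γ₁, (B.indicator 1 Γ₁ + b) ∂(SimpleGraph.binomialRandom V p₁) := by
        refine lintegral_mono fun Γ₁ => ?_
        by_cases hΓ : Γ₁ ∈ B
        · simp only [hΓ, Set.indicator_of_mem, Pi.one_apply]
          exact prob_le_one.trans le_self_add
        · simp only [hΓ, not_false_eq_true, Set.indicator_of_notMem, zero_add]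
          exact hb _ hΓ
    _ = _ := by
        rw [lintegral_add_right _ measurable_const, lintegral_indicator_one .of_discrete]
        simp

theorem toNNReal_symm_pow_le (p : I) {m : ℕ} {x : ℝ} (hx : x ≤ m) :
    (toNNReal (σ p) : ENNReal) ^ m ≤ ENNReal.ofReal (Real.exp (-(p * x))) := by
  have h0 : (0 : ℝ) ≤ p := p.2.1
  have h1 : ((σ p : I) : ℝ) ≤ Real.exp (-p) := by
    rw [coe_symm_eq]
    linarith [Real.add_one_le_exp (-(p : ℝ))]
  have h2 : (toNNReal (σ p) : ENNReal) = ENNReal.ofReal (σ p) :=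
    (ENNReal.ofReal_eq_coe_nnreal (σ p).2.1).symm
  rw [h2, ← ENNReal.ofReal_pow (σ p).2.1]
  refine ENNReal.ofReal_le_ofReal ?_
  calc ((σ p : I) : ℝ) ^ m ≤ Real.exp (-p) ^ m := by
        have := (σ p).2.1
        gcongr
    _ = Real.exp (-(p * m)) := by rw [← Real.exp_nat_mul]; ring_nf
    _ ≤ _ := by gcongr

theorem card_pow_mul_exp_le (n m : ℕ) (x : ℝ) :
    ((n : ENNReal) ^ m) * ENNReal.ofReal (Real.exp x) ≤ ENNReal.ofReal (Real.exp (m * n + x)) := by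
  rw [Real.exp_add, Real.exp_nat_mul, ENNReal.ofReal_mul (by positivity),
    ENNReal.ofReal_pow (by positivity)]
  gcongr
  rw [← ENNReal.ofReal_natCast]
  exact ENNReal.ofReal_le_ofReal (by linarith [Real.add_one_le_exp (n : ℝ)])

/-- If `R` is a dense set of pairs, then the random graph contains a pair of `R` at a positive
proportion of the vertices, up to an exponentially small failure probability. -/
theorem binomialRandom_hit {n : ℕ} {p : I} {c C : ℝ} (hc : 0 < c) (hn : 4 ≤ c * n)
    (hp : C ≤ p * n) {R : Fin n × Fin n → Prop} (hR : HasDensity c R) :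
    SimpleGraph.binomialRandom (Fin n) p
      {Γ | ¬ HasDensity (c / 2) (fun u => ∃ v, R (u, v) ∧ Γ.Adj v u)} ≤
      ENNReal.ofReal (Real.exp ((1 - C * c / 8) * n)) := by
  classical
  let D : Finset (Fin n) → Finset (Fin n × Fin n) := fun X =>
    Finset.univ.filter fun x => R x ∧ x.1 ∉ X ∧ x.1 ≠ x.2
  let S : Finset (Fin n) → Finset (Sym2 (Fin n)) := fun X => (D X).image fun x => s(x.1, x.2)
  -- Let X be the set of vertices u that are hit. If it is too small, no pair of `R` with first
  -- entry outside X is a random edge. From the at least cn² pairs one removes at most cn²/2 with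
  -- first entry in X and n diagonal ones, and n ≤ cn²/4. The union bound over X costs 2^n.
  have hD : ∀ X : Finset (Fin n), (X.card : ℝ) < c / 2 * n → c * n ^ 2 / 4 ≤ (D X).card := by
    intro X hX
    have hsub : Finset.univ.filter R ⊆
        D X ∪ ((X ×ˢ Finset.univ) ∪ Finset.univ.image fun u => (u, u)) := by
      intro x hx
      simp only [Finset.mem_filter, Finset.mem_univ, true_and] at hx
      simp only [D, Finset.mem_union, Finset.mem_filter, Finset.mem_univ, true_and,
        Finset.mem_product, and_true, Finset.mem_image]
      by_cases h1 : x.1 ∈ X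
      · tauto
      by_cases h2 : x.1 = x.2
      · exact Or.inr (Or.inr ⟨x.1, Prod.ext rfl h2⟩)
      · tauto
    have h1 := (Finset.card_le_card hsub).trans ((Finset.card_union_le _ _).trans
      (Nat.add_le_add_left ((Finset.card_union_le _ _).trans
        (Nat.add_le_add_left Finset.card_image_le _)) _))
    rw [Finset.card_product, Finset.card_univ, Fintype.card_fin] at h1
    have h2 : c * (n * n) ≤ ((Finset.univ.filter R).card : ℝ) := by
      have := hR
      unfold HasDensity at this
      rw [Nat.card_eq_fintype_card, Fintype.card_subtype] at this
      simpa using this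
    have h3 : ((Finset.univ.filter R).card : ℝ) ≤ (D X).card + (X.card * n + n) := by
      exact_mod_cast h1
    have h4 : (X.card : ℝ) * n ≤ c / 2 * n * n := by gcongr
    nlinarith [(Nat.cast_nonneg n : (0 : ℝ) ≤ n)]
  have hS : ∀ X, (D X).card ≤ 2 * (S X).card := by
    intro X
    refine Finset.card_le_mul_card_image _ _ fun e _ => ?_
    induction e with
    | _ u v =>
    refine (Finset.card_le_card (t := {(u, v), (v, u)}) ?_).trans Finset.card_le_two
    intro x hx
    simp only [Finset.mem_filter, Sym2.eq_iff] at hx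
    simp only [Finset.mem_insert, Finset.mem_singleton, Prod.ext_iff]
    exact hx.2
  have hcover : {Γ : SimpleGraph (Fin n) |
      ¬ HasDensity (c / 2) (fun u => ∃ v, R (u, v) ∧ Γ.Adj v u)} ⊆
      ⋃ X ∈ Finset.univ.filter (fun X : Finset (Fin n) => (X.card : ℝ) < c / 2 * n),
        {Γ : SimpleGraph (Fin n) | ∀ e ∈ S X, e ∉ Γ.edgeSet} := by
    intro Γ hΓ
    simp only [Set.mem_ofPred_eq, HasDensity, not_le, Nat.card_eq_fintype_card,
      Fintype.card_subtype, Fintype.card_fin] at hΓ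
    simp only [Set.mem_iUnion]
    refine ⟨_, by simpa using hΓ, ?_⟩
    intro e he
    simp only [S, D, Finset.mem_image, Finset.mem_filter, Finset.mem_univ, true_and] at he
    obtain ⟨x, ⟨hx1, hx2, -⟩, rfl⟩ := he
    intro h
    exact hx2 ⟨x.2, hx1, (SimpleGraph.mem_edgeSet _).1 h |>.symm⟩
  refine (measure_mono hcover).trans ((measure_biUnion_finset_le _ _).trans ?_)
  have hbound : ∀ X ∈ Finset.univ.filter (fun X : Finset (Fin n) => (X.card : ℝ) < c / 2 * n),
      SimpleGraph.binomialRandom (Fin n) p {Γ : SimpleGraph (Fin n) | ∀ e ∈ S X, e ∉ Γ.edgeSet} ≤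
        ENNReal.ofReal (Real.exp (-(C * c / 8 * n))) := by
    intro X hX
    rw [binomialRandom_avoid]
    · have h1 := hD X (by simpa using hX)
      have h2 : ((D X).card : ℝ) ≤ 2 * (S X).card := by exact_mod_cast hS X
      refine (toNNReal_symm_pow_le p (x := c * n ^ 2 / 8) (by linarith)).trans ?_
      refine ENNReal.ofReal_le_ofReal (Real.exp_le_exp.2 ?_)
      have := mul_le_mul_of_nonneg_right hp (by positivity : 0 ≤ c / 8 * n)
      nlinarith
    · intro e he
      simp only [S, D, Finset.mem_image, Finset.mem_filter, Finset.mem_univ, true_and] at he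
      obtain ⟨x, ⟨-, -, hx⟩, rfl⟩ := he
      simpa using hx
  refine (Finset.sum_le_card_nsmul _ _ _ hbound).trans ?_
  rw [nsmul_eq_mul]
  have hcard : ((Finset.univ.filter
      (fun X : Finset (Fin n) => (X.card : ℝ) < c / 2 * n)).card : ENNReal) ≤
      ENNReal.ofReal (Real.exp n) := by
    have h1 : (Finset.univ.filter
      (fun X : Finset (Fin n) => (X.card : ℝ) < c / 2 * n)).card ≤ 2 ^ n := by
      refine (Finset.card_le_univ _).trans ?_
      simp
    rw [← ENNReal.ofReal_natCast]
    refine ENNReal.ofReal_le_ofReal ?_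
    calc _ ≤ ((2 ^ n : ℕ) : ℝ) := by exact_mod_cast h1
      _ = 2 ^ n := by push_cast; rfl
      _ ≤ Real.exp 1 ^ n := by
        gcongr
        linarith [Real.add_one_le_exp (1 : ℝ)]
      _ = _ := by rw [← Real.exp_nat_mul, mul_one]
  refine (mul_le_mul_left hcard _).trans ?_
  rw [← ENNReal.ofReal_mul (by positivity), ← Real.exp_add]
  refine ENNReal.ofReal_le_ofReal (Real.exp_le_exp.2 (le_of_eq (by ring)))

/-- Among the tuples of a dense family, one can expose the random edges between the first vertex
and another one, and keep a dense family of shorter tuples. -/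
theorem binomialRandom_eliminate {n : ℕ} {p : I} {c C : ℝ} (hc : 0 < c) (hn : 8 ≤ c * n)
    (hp : C ≤ p * n) {M : ℕ} (e : Fin M) {F : (Fin (M + 1) → Fin n) → Prop}
    (hF : HasDensity c F) :
    SimpleGraph.binomialRandom (Fin n) p
      {Γ | ¬ HasDensity (c ^ 2 / 8) (fun f : Fin M → Fin n =>
        ∃ v, F (Fin.cons v f) ∧ Γ.Adj v (f e))} ≤
      ENNReal.ofReal (Real.exp ((M - C * c / 16) * n)) := by
  classical
  obtain _ | M := M
  · exact e.elim0
  have : NeZero n := ⟨by rintro rfl; norm_num at hn⟩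
  let E₁ : (Fin M → Fin n) × Fin n ≃ (Fin (M + 1) → Fin n) :=
    (Equiv.prodComm _ _).trans (Fin.insertNthEquiv (fun _ => Fin n) e)
  let E₂ : (Fin M → Fin n) × (Fin n × Fin n) ≃ (Fin (M + 2) → Fin n) :=
    (Equiv.prodAssoc _ _ _).symm.trans ((Equiv.prodCongr E₁ (Equiv.refl _)).trans
      ((Equiv.prodComm _ _).trans (Fin.consEquiv (fun _ => Fin n))))
  let R : (Fin M → Fin n) → Fin n × Fin n → Prop := fun a x => F (E₂ (a, x))
  have hR : HasDensity c (fun x : (Fin M → Fin n) × (Fin n × Fin n) => R x.1 x.2) :=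
    HasDensity.of_equiv E₂.symm (by simpa [R] using hF)
  have hslice := hR.slices hc.le
  -- Fixing all coordinates except the first one and the one at `e` leaves a set of pairs. A
  -- proportion c/2 of these slices have density c/2, and `binomialRandom_hit` keeps c/4 in each,
  -- whence c²/8. The number of slices is absorbed by n ≤ exp(n).
  have hsub : {Γ : SimpleGraph (Fin n) | ¬ HasDensity (c ^ 2 / 8) (fun f : Fin (M + 1) → Fin n =>
        ∃ v, F (Fin.cons v f) ∧ Γ.Adj v (f e))} ⊆
      ⋃ a ∈ Finset.univ.filter (fun a => HasDensity (c / 2) (R a)),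
        {Γ | ¬ HasDensity (c / 2 / 2) (fun u => ∃ v, R a (u, v) ∧ Γ.Adj v u)} := by
    intro Γ hΓ
    by_contra hcon
    refine hΓ ?_
    simp only [Set.mem_iUnion, Finset.mem_filter, Finset.mem_univ, true_and, not_exists,
      Set.mem_ofPred_eq, not_not, exists_prop, not_and] at hcon
    refine HasDensity.of_equiv E₁ (((hslice.and_prod (by positivity) hcon).mono_left
      (by apply le_of_eq; ring)).mono ?_)
    rintro ⟨a, u⟩ ⟨-, v, hv, hadj⟩
    refine ⟨v, hv, ?_⟩
    simpa [E₁] using hadj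
  refine (measure_mono hsub).trans ((measure_biUnion_finset_le _ _).trans ?_)
  refine (Finset.sum_le_card_nsmul _ _ _ fun a ha => binomialRandom_hit (by positivity) (by linarith)
    hp (by simpa using ha)).trans ?_
  rw [nsmul_eq_mul]
  have hcard : ((Finset.univ.filter (fun a => HasDensity (c / 2) (R a))).card : ENNReal) ≤
      (n : ENNReal) ^ M := by
    have : (Finset.univ.filter (fun a => HasDensity (c / 2) (R a))).card ≤ n ^ M := by
      refine (Finset.card_le_univ _).trans ?_
      simp
    exact_mod_cast this
  refine (mul_le_mul_left hcard _).trans ((card_pow_mul_exp_le _ _ _).trans ?_)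
  refine ENNReal.ofReal_le_ofReal (Real.exp_le_exp.2 (le_of_eq ?_))
  push_cast
  ring

/-- The random graph contains `r` vertex-disjoint paths `f i, f (i + r), f (i + 2 * r), …` for some
`f` in a given dense family of tuples, up to an exponentially small failure probability. -/
theorem binomialRandom_braid {r : ℕ} (hr : 1 ≤ r) (L : ℝ) (M : ℕ) (c : ℝ) (hc : 0 < c) :
    ∃ (C : ℝ) (n₀ : ℕ), ∀ n ≥ n₀, ∀ p : I, C ≤ p * n → ∀ F : (Fin M → Fin n) → Prop,
      HasDensity c F →
      SimpleGraph.binomialRandom (Fin n) p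
        {Γ | ¬ ∃ f, F f ∧ ∀ i j : Fin M, (i : ℕ) + r = j → Γ.Adj (f i) (f j)} ≤
      ENNReal.ofReal (M * Real.exp (-(L * n))) := by
  induction M generalizing c with
  | zero =>
    refine ⟨0, 0, fun n _ p _ F hF => ?_⟩
    obtain ⟨f, hf⟩ := hF.exists_of_pos hc
    have : {Γ : SimpleGraph (Fin n) |
      ¬ ∃ f, F f ∧ ∀ i j : Fin 0, (i : ℕ) + r = j → Γ.Adj (f i) (f j)} = ∅ := by
      ext Γ
      simp only [Set.mem_ofPred_eq, Set.mem_empty_iff_false, iff_false, not_not]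
      exact ⟨f, hf, fun i => i.elim0⟩
    rw [this]
    simp
  | succ M ih =>
    obtain ⟨C', n₀, h⟩ := ih (c ^ 2 / 8) (by positivity)
    -- The factor 2 pays for splitting p into two rounds. The second entry of the maximum turns the
    -- exponent (M - Cc/16)n of `binomialRandom_eliminate` into -Ln.
    refine ⟨2 * max C' (16 * (M + L) / c), max n₀ (⌈8 / c⌉₊ + 1), fun n hn p hp F hF => ?_⟩
    have hn₀ : n₀ ≤ n := (le_max_left _ _).trans hn
    have hn8 : ⌈8 / c⌉₊ + 1 ≤ n := (le_max_right _ _).trans hn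
    have hcn : 8 ≤ c * n := by
      have : (8 / c : ℝ) ≤ n := (Nat.le_ceil _).trans (by exact_mod_cast (Nat.le_succ _).trans hn8)
      rwa [div_le_iff₀' hc] at this
    have : NeZero n := ⟨by omega⟩
    by_cases hrM : r ≤ M
    · have hp0 : (0 : ℝ) ≤ p := p.2.1
      have hp1 : (p : ℝ) ≤ 1 := p.2.2
      have hs0 := Real.sqrt_nonneg (1 - p : ℝ)
      have hs : Real.sqrt (1 - p : ℝ) ^ 2 = 1 - p := Real.sq_sqrt (by linarith)
      have hs1 : Real.sqrt (1 - p : ℝ) ≤ 1 := Real.sqrt_le_one.2 (by linarith)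
      -- Two independent rounds of density q give density p, because 1 - p = (1 - q)².
      let q : I := ⟨1 - Real.sqrt (1 - p), by linarith, by linarith⟩
      have hq : (σ p : ℝ) = σ q * σ q := by
        simp only [coe_symm_eq, q]
        nlinarith
      have hpq : (p : ℝ) / 2 ≤ q := by
        change (p : ℝ) / 2 ≤ 1 - Real.sqrt (1 - p)
        nlinarith
      have hqn : max C' (16 * (M + L) / c) ≤ q * n := by
        have := mul_le_mul_of_nonneg_right hpq (Nat.cast_nonneg n : (0 : ℝ) ≤ n)
        linarith
      -- The partner of index 0 is index r, which becomes r - 1 once the first entry is deleted.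
      let e : Fin M := ⟨r - 1, by omega⟩
      let F' : SimpleGraph (Fin n) → (Fin M → Fin n) → Prop := fun Γ f =>
        ∃ v, F (Fin.cons v f) ∧ Γ.Adj v (f e)
      refine (binomialRandom_le_of_sup hq _ {Γ | ¬ HasDensity (c ^ 2 / 8) (F' Γ)}
        (b := ENNReal.ofReal (M * Real.exp (-(L * n)))) ?_).trans ?_
      · intro Γ₁ hΓ₁
        simp only [Set.mem_ofPred_eq, not_not] at hΓ₁
        refine (measure_mono ?_).trans (h n hn₀ q ((le_max_left _ _).trans hqn) _ hΓ₁)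
        intro Γ₂ hΓ₂ hex
        refine hΓ₂ ?_
        obtain ⟨f, ⟨v, hv, hadj⟩, hf⟩ := hex
        refine ⟨Fin.cons v f, hv, fun i j hij => ?_⟩
        induction i using Fin.cases with
        | zero =>
          have : j = Fin.succ e := by
            ext
            simp only [Fin.val_zero, zero_add] at hij
            simp only [Fin.val_succ, e]
            omega
          subst this
          exact Or.inl (by simpa using hadj)
        | succ i =>
          induction j using Fin.cases with
          | zero => simp at hij
          | succ j =>
            refine Or.inr ?_
            simp only [Fin.cons_succ]
            refine hf i j ?_
            simp only [Fin.val_succ] at hij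
            omega
      · refine (add_le_add_left (binomialRandom_eliminate hc hcn
          ((le_max_right _ _).trans hqn) e hF) _).trans ?_
        rw [← ENNReal.ofReal_add (by positivity) (by positivity)]
        refine ENNReal.ofReal_le_ofReal (le_of_eq ?_)
        have : ((M : ℝ) - 16 * (M + L) / c * c / 16) * n = -(L * n) := by
          field_simp
          ring
        rw [this]
        push_cast
        ring
    -- When r exceeds M, no two indices differ by r and any tuple of the family works.
    · obtain ⟨f, hf⟩ := hF.exists_of_pos hc
      have : {Γ : SimpleGraph (Fin n) |
        ¬ ∃ f, F f ∧ ∀ i j : Fin (M + 1), (i : ℕ) + r = j → Γ.Adj (f i) (f j)} = ∅ := by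
        ext Γ
        simp only [Set.mem_ofPred_eq, Set.mem_empty_iff_false, iff_false, not_not]
        exact ⟨f, hf, fun i j hij => by omega⟩
      rw [this]
      simp

end

/-! ### Attaching the end cliques and flattening blocks into tuples. -/

theorem IsWalk.cons_block {V : Type*} {G : SimpleGraph V} {r m : ℕ} {K x : Fin r → V}
    {W : Fin m → Fin r → V} (hW : IsWalk G x W) (hx : IsCliqueTuple G x) (hK : Step G K x) :
    IsWalk G K (Fin.cons x W : Fin (m + 1) → Fin r → V) where
  first a ha := by
    have : a = 0 := Fin.ext ha
    subst this
    simpa using hK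
  step a b hab := by
    induction b using Fin.cases with
    | zero => simp at hab
    | succ b =>
      induction a using Fin.cases with
      | zero => simpa using hW.first b (by simpa using hab.symm)
      | succ a => simpa using hW.step a b (by simpa using hab)
  clique a := by
    induction a using Fin.cases with
    | zero => simpa using hx
    | succ a => simpa using hW.clique a

/-- The blocks `B` connect `K` and `K'` in `G`, in the sense of a copy of a power of a path, except
that equal columns of consecutive blocks of `B` need not be adjacent. -/
structure BlocksConnect {V : Type*} (G : SimpleGraph V) {r m : ℕ} (K K' : Fin r → V)
    (B : Fin (m + 1) → Fin r → V) : Prop where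
  walk : IsWalk G K B
  first : ∀ i j, j ≤ i → G.Adj (K i) (B 0 j)
  last : ∀ i j, j ≤ i → G.Adj (B (Fin.last m) i) (K' j)

-- A first block x and a last block y are chosen next to K and K', and `density_walk` links them.
-- Entry i of x meets s + 1 - i constraints from K and i from earlier entries; entry i of y meets i
-- + 1 from K' and s - i from later entries. The total is always s + 1, which dictates choosing x
-- from the left and y from the right.
open Classical in
theorem density_blocksConnect (s : ℕ) (γ : ℝ) (hγ : 0 < γ) :
    ∃ c : ℝ, 0 < c ∧ ∀ (V : Type) [Fintype V] (G : SimpleGraph V) (d : ℕ),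
      (∀ v, (Finset.univ.filter fun u => ¬ G.Adj v u).card ≤ d) →
      ∀ (U : Finset V) (K K' : Fin (s + 1) → V),
      γ * Fintype.card V + (s + 1) * d ≤ U.card →
      HasDensity c (fun B : Fin (walkLength s + 1 + 1) → Fin (s + 1) → V =>
        (∀ a i, B a i ∈ U) ∧ BlocksConnect G K K' B) := by
  obtain ⟨c, hc, hwalk⟩ := density_walk s γ hγ
  generalize walkLength s = m at hwalk ⊢
  refine ⟨γ ^ (s + 1) * γ ^ (s + 1) * c, by positivity, fun V _ G d hd U K K' hU => ?_⟩
  have hd0 : (0 : ℝ) ≤ d := Nat.cast_nonneg d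
  obtain ⟨S, hS⟩ : ∃ S : Fin (s + 1) → Finset V, ∀ i, S i =
      U.filter fun u => ∀ j ∈ Finset.Ici i, G.Adj (K j) u := ⟨_, fun _ => rfl⟩
  obtain ⟨S', hS'⟩ : ∃ S' : Fin (s + 1) → Finset V, ∀ i, S' i =
      U.filter fun u => ∀ j ∈ Finset.Iic i, G.Adj (K' j) u := ⟨_, fun _ => rfl⟩
  have hScard : ∀ i : Fin (s + 1), γ * Fintype.card V + (i : ℕ) * d ≤ (S i).card := by
    intro i
    have h1 := card_le_of_common_nbrs hd U (S i) (Finset.Ici i) K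
      fun u hu h => by rw [hS]; exact Finset.mem_filter.2 ⟨hu, h⟩
    rw [Fin.card_Ici] at h1
    have h2 : (U.card : ℝ) ≤ (S i).card + ((s + 1 - (i : ℕ) : ℕ) : ℝ) * d := by exact_mod_cast h1
    rw [Nat.cast_sub (by omega)] at h2
    push_cast at h2
    linarith
  have hScard' : ∀ i : Fin (s + 1),
      γ * Fintype.card V + ((s + 1 : ℕ) - 1 - i : ℝ) * d ≤ (S' i).card := by
    intro i
    have h1 := card_le_of_common_nbrs hd U (S' i) (Finset.Iic i) K'
      fun u hu h => by rw [hS']; exact Finset.mem_filter.2 ⟨hu, h⟩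
    rw [Fin.card_Iic] at h1
    have h2 : (U.card : ℝ) ≤ (S' i).card + (i + 1) * d := by exact_mod_cast h1
    push_cast
    linarith
  have h1 := density_cliqueTuple hd hγ.le (s + 1) S hScard
  have h2 := h1.and_prod (Q := fun (_ : Fin (s + 1) → V) (y : Fin (s + 1) → V) =>
    (∀ i, y i ∈ S' i) ∧ IsCliqueTuple G y) (by positivity)
    fun _ _ => density_cliqueTuple_rev hd hγ.le (s + 1) S' hScard'
  have h3 := h2.and_prod
    (Q := fun (ω : (Fin (s + 1) → V) × (Fin (s + 1) → V)) (w : Fin m → Fin (s + 1) → V) =>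
    (∀ a i, w a i ∈ U) ∧
      IsWalk G ω.1 (Fin.snoc w ω.2 : Fin (m + 1) → Fin (s + 1) → V)) hc.le
    fun ω hω => hwalk V G d hd U ω.1 ω.2 hω.2.2 hU
  let e : ((Fin (s + 1) → V) × (Fin (s + 1) → V)) × (Fin m → Fin (s + 1) → V) ≃
      (Fin (m + 1 + 1) → Fin (s + 1) → V) := (Equiv.prodAssoc _ _ _).trans (((Equiv.refl _).prodCongr
    (Fin.snocEquiv fun _ => Fin (s + 1) → V)).trans (Fin.consEquiv fun _ => Fin (s + 1) → V))
  have he : ∀ x y w, e ((x, y), w) =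
      Fin.cons x (Fin.snoc w y : Fin (m + 1) → Fin (s + 1) → V) := fun _ _ _ => rfl
  refine HasDensity.of_equiv e (h3.mono ?_)
  rintro ⟨⟨x, y⟩, w⟩ ⟨⟨⟨hx, hxc⟩, hy, hyc⟩, hwU, hw⟩
  simp only [hS, hS', Finset.mem_filter, Finset.mem_Ici, Finset.mem_Iic] at hx hy
  rw [he]
  constructor
  · intro a
    induction a using Fin.cases with
    | zero => exact fun i => (hx i).1
    | succ a =>
      rw [Fin.cons_succ]
      induction a using Fin.lastCases with
      | last =>
        rw [Fin.snoc_last]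
        exact fun i => (hy i).1
      | cast a =>
        rw [Fin.snoc_castSucc]
        exact hwU a
  · refine ⟨hw.cons_block hxc fun i j hij => (hx j).2 i hij.le, fun i j hij => ?_,
      fun i j hij => ?_⟩
    · rw [Fin.cons_zero]
      exact (hx j).2 i hij
    · rw [← Fin.succ_last, Fin.cons_succ, Fin.snoc_last]
      exact ((hy i).2 j hij).symm

/-- The tuple `f` connects `K` and `K'` in `G`, in the sense of a copy of the `r`-th power of a
path, except that vertices of `f` at distance exactly `r` need not be adjacent. -/
structure TupleConnects {V : Type*} (G : SimpleGraph V) {r M : ℕ} (K K' : Fin r → V)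
    (f : Fin M → V) : Prop where
  inner : ∀ t t' : Fin M, t < t' → (t' : ℕ) < t + r → G.Adj (f t) (f t')
  first : ∀ (i : Fin r) (t : Fin M), (t : ℕ) ≤ i → G.Adj (K i) (f t)
  last : ∀ (t : Fin M) (i : Fin r), M + (i : ℕ) ≤ t + r → G.Adj (f t) (K' i)

/-- Index t sits in block t / r and column t % r. Two indices at distance less than r lie in the
same block, where the clique condition applies, or in consecutive blocks with the later one in a
smaller column, which is what `Step` covers. -/
theorem BlocksConnect.tupleConnects {V : Type*} {G : SimpleGraph V} {r m : ℕ} {K K' : Fin r → V}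
    {B : Fin (m + 1) → Fin r → V} (h : BlocksConnect G K K' B) :
    TupleConnects G K K' (fun t : Fin ((m + 1) * r) => B t.divNat t.modNat) where
  inner t t' htt' hr := by
    have h1 : (t : ℕ) % r + r * (t / r) = t := Nat.mod_add_div _ _
    have h2 : (t' : ℕ) % r + r * (t' / r) = t' := Nat.mod_add_div _ _
    have hr0 : 0 < r := by
      rcases Nat.eq_zero_or_pos r with rfl | h
      · simp only [add_zero] at hr
        exact absurd hr (not_lt.2 htt'.le)
      · exact h
    have hlt : (t : ℕ) < t' := htt'
    have h3 : (t : ℕ) / r ≤ t' / r := Nat.div_le_div_right hlt.le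
    have h4 : (t' : ℕ) / r ≤ t / r + 1 := by
      rw [← Nat.add_div_right _ hr0]
      exact Nat.div_le_div_right hr.le
    rcases Nat.lt_or_ge ((t : ℕ) / r) (t' / r) with h5 | h5
    · have h6 : (t' : ℕ) / r = t / r + 1 := by omega
      refine h.walk.step _ _ h6.symm _ _ ?_
      rw [Fin.lt_def, Fin.coe_modNat, Fin.coe_modNat]
      rw [h6, Nat.mul_add] at h2
      omega
    · have h6 : (t' : ℕ) / r = t / r := by omega
      have h7 : t'.divNat = t.divNat := Fin.ext h6
      rw [h7]
      refine h.walk.clique _ _ _ fun heq => ?_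
      have := congrArg Fin.val heq
      rw [Fin.coe_modNat, Fin.coe_modNat] at this
      rw [h6] at h2
      omega
  first i t hti := by
    have h1 : (t : ℕ) < r := hti.trans_lt i.2
    have h2 : t.divNat = 0 := Fin.ext (Nat.div_eq_of_lt h1)
    rw [h2]
    refine h.first _ _ ?_
    rw [Fin.le_def, Fin.coe_modNat, Nat.mod_eq_of_lt h1]
    exact hti
  last t i hti := by
    have h1 : (t : ℕ) % r + r * (t / r) = t := Nat.mod_add_div _ _
    have hr0 : 0 < r := i.pos
    have h0 := Nat.add_mul m 1 r
    have h2 : (t : ℕ) / r = m := by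
      refine le_antisymm (Nat.lt_succ_iff.1 (Nat.div_lt_of_lt_mul (t.2.trans_eq (mul_comm _ _)))) ?_
      rw [Nat.le_div_iff_mul_le hr0]
      omega
    have h3 : t.divNat = Fin.last m := Fin.ext h2
    rw [h3]
    refine h.last _ _ ?_
    rw [Fin.le_def, Fin.coe_modNat]
    rw [h2] at h1
    have := mul_comm r m
    omega

open Classical in
theorem density_tupleConnects (s : ℕ) (γ : ℝ) (hγ : 0 < γ) :
    ∃ c : ℝ, 0 < c ∧ ∀ (V : Type) [Fintype V] (G : SimpleGraph V) (d : ℕ),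
      (∀ v, (Finset.univ.filter fun u => ¬ G.Adj v u).card ≤ d) →
      ∀ (U : Finset V) (K K' : Fin (s + 1) → V),
      γ * Fintype.card V + (s + 1) * d ≤ U.card →
      HasDensity c (fun f : Fin ((s + 1) * 2 ^ (s + 1)) → V =>
        (∀ t, f t ∈ U) ∧ TupleConnects G K K' f) := by
  obtain ⟨c, hc, h⟩ := density_blocksConnect s γ hγ
  refine ⟨c, hc, fun V _ G d hd U K K' hU => ?_⟩
  have hM : (walkLength s + 1 + 1) * (s + 1) = (s + 1) * 2 ^ (s + 1) := by
    rw [mul_comm, ← walkLength_add_two]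
  rw [← hM]
  refine HasDensity.of_equiv ((Equiv.curry _ _ _).symm.trans
    (Equiv.arrowCongr finProdFinEquiv (Equiv.refl V))) ((h V G d hd U K K' hU).mono ?_)
  rintro B ⟨hB, hconn⟩
  exact ⟨fun t => hB _ _, hconn.tupleConnects⟩

/-! ### Injective tuples and assembly of the power of a path. -/

theorem HasDensity.inter {Ω : Type*} [Fintype Ω] {a b : ℝ} {P Q : Ω → Prop} (hP : HasDensity a P)
    (hQ : HasDensity (1 - b) Q) : HasDensity (a - b) (fun ω => P ω ∧ Q ω) := by
  classical
  unfold HasDensity at *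
  rw [Nat.card_eq_fintype_card, Fintype.card_subtype] at *
  have h1 := Finset.card_union_add_card_inter (Finset.univ.filter P) (Finset.univ.filter Q)
  have h2 : (Finset.univ.filter P ∪ Finset.univ.filter Q).card ≤ Fintype.card Ω :=
    Finset.card_le_univ _
  rw [← Finset.filter_and] at h1
  have h3 : ((Finset.univ.filter P).card : ℝ) + (Finset.univ.filter Q).card ≤
      Fintype.card Ω + (Finset.univ.filter fun ω => P ω ∧ Q ω).card := by
    exact_mod_cast h1.symm.le.trans (Nat.add_le_add_right h2 _)
  linarith

/-- For M < n the falling factorial is at least (n - M)^M, and Bernoulli's inequality applies; for M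
≥ n the bound is not positive. -/
theorem density_injective {n M : ℕ} (hn : 0 < n) :
    HasDensity (1 - M ^ 2 / n) (fun f : Fin M → Fin n => Function.Injective f) := by
  unfold HasDensity
  rw [Nat.card_congr (Equiv.subtypeInjectiveEquivEmbedding (Fin M) (Fin n)),
    Nat.card_eq_fintype_card, Fintype.card_embedding_eq]
  simp only [Fintype.card_fun, Fintype.card_fin]
  push_cast
  have hn0 : (0 : ℝ) < n := by exact_mod_cast hn
  rcases le_or_gt n M with h | h
  · refine le_trans (mul_nonpos_of_nonpos_of_nonneg ?_ (by positivity)) (Nat.cast_nonneg _)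
    have h1 : (n : ℝ) ≤ M := by exact_mod_cast h
    have h2 : (1 : ℝ) ≤ M := by exact_mod_cast (Nat.succ_le_of_lt hn).trans h
    rw [sub_nonpos, one_le_div hn0]
    nlinarith
  · have h1 : (n : ℝ) - M ≤ ((n + 1 - M : ℕ) : ℝ) := by
      rw [Nat.cast_sub (by omega)]
      push_cast
      linarith
    have hMn : (M : ℝ) ≤ n := by exact_mod_cast h.le
    have h2 := one_add_mul_le_pow (a := -(M / n : ℝ)) (by
      have : (M : ℝ) / n ≤ 1 := by rwa [div_le_one hn0]
      linarith) M
    calc (1 - (M : ℝ) ^ 2 / n) * n ^ M = (1 + M * -(M / n : ℝ)) * n ^ M := by ring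
      _ ≤ (1 + -(M / n : ℝ)) ^ M * n ^ M := by gcongr
      _ = (n - M : ℝ) ^ M := by
          rw [← mul_pow]
          congr 1
          field_simp
          ring
      _ ≤ ((n + 1 - M : ℕ) : ℝ) ^ M := by
          have : (0 : ℝ) ≤ n - M := by linarith
          gcongr
      _ ≤ _ := by exact_mod_cast Nat.pow_sub_le_descFactorial n M

theorem val_le_of_walk_pathGraph {m : ℕ} {u v : Fin m} (w : (SimpleGraph.pathGraph m).Walk u v) :
    (v : ℕ) ≤ u + w.length := by
  induction w with
  | nil => simp
  | cons h _ ih =>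
    rw [SimpleGraph.Walk.length_cons]
    have := SimpleGraph.pathGraph_adj.1 h
    omega

theorem val_le_of_pathGraph_edist_le {m r : ℕ} {u v : Fin m}
    (h : (SimpleGraph.pathGraph m).edist u v ≤ r) : (v : ℕ) ≤ u + r := by
  obtain ⟨w, hw⟩ := SimpleGraph.exists_walk_of_edist_ne_top
    (ne_top_of_le_ne_top (ENat.natCast_ne_top r) h)
  rw [← hw] at h
  exact (val_le_of_walk_pathGraph w).trans (Nat.add_le_add_left (by exact_mod_cast h) _)

/-- The path is K, f, K' in this order. Pairs inside an end are adjacent by the clique hypotheses,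
pairs in f at distance exactly r by `hbraid`, and the other close pairs by `hconn`. Since r ≤ M, no
vertex of K is within distance r of one of K'. -/
theorem TupleConnects.exists_powerPath {V : Type*} {G Γ : SimpleGraph V} {r M : ℕ} (hrM : r ≤ M)
    {K K' : Fin r → V} {f : Fin M → V} (hK : IsOrderedClique (G ⊔ Γ) K)
    (hK' : IsOrderedClique (G ⊔ Γ) K') (hKK' : Disjoint (Set.range K) (Set.range K'))
    (hf : Function.Injective f) (hfK : ∀ t i, f t ≠ K i) (hfK' : ∀ t i, f t ≠ K' i)
    (hconn : TupleConnects G K K' f)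
    (hbraid : ∀ t t' : Fin M, (t : ℕ) + r = t' → Γ.Adj (f t) (f t')) :
    ∃ P : PowerPath (G ⊔ Γ) r, P.Connects K K' ∧ P.internalVertices K K' = Set.range f := by
  set v : Fin (r + M + r) → V := Fin.append (Fin.append K f) K' with hv
  have hKinj : Function.Injective K := fun i j h => by
    by_contra hij
    exact (hK i j hij).1 h
  have hKinj' : Function.Injective K' := fun i j h => by
    by_contra hij
    exact (hK' i j hij).1 h
  have hvinj : Function.Injective v := by
    rw [hv, Fin.append_injective_iff, Fin.append_injective_iff]
    refine ⟨⟨hKinj, hf, fun i t => (hfK t i).symm⟩, hKinj', fun a i => ?_⟩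
    induction a using Fin.addCases with
    | left a =>
      rw [Fin.append_left]
      exact fun h => Set.disjoint_left.1 hKK' ⟨a, rfl⟩ ⟨i, h.symm⟩
    | right t =>
      rw [Fin.append_right]
      exact hfK' t i
  have hadj : ∀ a b : Fin (r + M + r), a < b → (b : ℕ) ≤ a + r → (G ⊔ Γ).Adj (v a) (v b) := by
    intro a b hab hba
    rw [Fin.lt_def] at hab
    induction a using Fin.addCases with
    | left a =>
      induction a using Fin.addCases with
      | left i =>
        induction b using Fin.addCases with
        | left b =>
          induction b using Fin.addCases with
          | left j =>
            simp only [hv, Fin.append_left]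
            refine (hK i j fun h => ?_).2
            subst h
            exact lt_irrefl _ hab
          | right t =>
            simp only [hv, Fin.append_left, Fin.append_right]
            simp only [Fin.val_castAdd, Fin.val_natAdd] at hba
            exact Or.inl (hconn.first i t (by omega))
        | right j =>
          simp only [Fin.val_castAdd, Fin.val_natAdd] at hba
          omega
      | right t =>
        induction b using Fin.addCases with
        | left b =>
          induction b using Fin.addCases with
          | left j =>
            simp only [Fin.val_castAdd, Fin.val_natAdd] at hab
            omega
          | right t' =>
            simp only [hv, Fin.append_left, Fin.append_right]
            simp only [Fin.val_castAdd, Fin.val_natAdd] at hab hba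
            rcases Nat.lt_or_ge t' ((t : ℕ) + r) with h | h
            · exact Or.inl (hconn.inner t t' (by rw [Fin.lt_def]; omega) h)
            · exact Or.inr (hbraid t t' (by omega))
        | right j =>
          simp only [hv, Fin.append_left, Fin.append_right]
          simp only [Fin.val_castAdd, Fin.val_natAdd] at hba
          exact Or.inl (hconn.last t j (by omega))
    | right i =>
      induction b using Fin.addCases with
      | left b =>
        simp only [Fin.val_castAdd, Fin.val_natAdd] at hab
        omega
      | right j =>
        simp only [hv, Fin.append_right]
        refine (hK' i j fun h => ?_).2
        subst h
        exact lt_irrefl _ hab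
  let P : PowerPath (G ⊔ Γ) r :=
    { order := r + M + r
      copy :=
        { toHom :=
            { toFun := v
              map_rel' := by
                rintro a b ⟨hne, hd⟩
                rcases lt_or_gt_of_ne hne with h | h
                · exact hadj a b h (val_le_of_pathGraph_edist_le hd)
                · rw [SimpleGraph.edist_comm] at hd
                  exact (hadj b a h (val_le_of_pathGraph_edist_le hd)).symm }
          injective' := hvinj } }
  have hP : ∀ a, P.copy a = v a := fun _ => rfl
  refine ⟨P, ⟨(by omega : r ≤ r + M + r), fun i => ?_, fun i => ?_⟩, ?_⟩
  · rw [hP]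
    have : (⟨i, by omega⟩ : Fin (r + M + r)) = Fin.castAdd r (Fin.castAdd M i) := rfl
    exact (congrArg v this).trans (by simp [hv])
  · rw [hP]
    have : (⟨r + M + r - r + i, by omega⟩ : Fin (r + M + r)) = Fin.natAdd (r + M) i :=
      Fin.ext (by simp)
    exact (congrArg v this).trans (by simp [hv])
  · have hrange : Set.range P.copy = Set.range v := rfl
    rw [PowerPath.internalVertices, hrange]
    ext x
    constructor
    · rintro ⟨⟨a, rfl⟩, hx⟩
      induction a using Fin.addCases with
      | left a =>
        induction a using Fin.addCases with
        | left i => exact absurd (Or.inl ⟨i, by simp [hv]⟩) hx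
        | right t => exact ⟨t, by simp [hv]⟩
      | right i => exact absurd (Or.inr ⟨i, by simp [hv]⟩) hx
    · rintro ⟨t, rfl⟩
      refine ⟨⟨Fin.castAdd r (Fin.natAdd r t), by simp [hv]⟩, ?_⟩
      rintro (⟨i, hi⟩ | ⟨i, hi⟩)
      · exact hfK t i hi.symm
      · exact hfK' t i hi.symm

/-! ### Union bound over the cliques and the forbidden set. -/

open MeasureTheory unitInterval

/-- The conclusion of the Connecting Lemma for the union of `G` and a sample `Γ` of the random
graph. -/
def HasConnectingPaths (k : ℕ) (ε : ℝ) {n : ℕ} (G Γ : SimpleGraph (Fin n)) : Prop :=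
  ∀ Z : Finset (Fin n), (Z.card : ℝ) ≤ ε * (n : ℝ) / 2 →
    ∀ K K' : Fin (k + 1) → Fin n,
      IsOrderedClique (G ⊔ Γ) K → IsOrderedClique (G ⊔ Γ) K' →
      Disjoint (Set.range K) (Set.range K') →
      ∃ P : PowerPath (G ⊔ Γ) (k + 1),
        P.Connects K K' ∧
        (P.internalVertices K K').ncard = (k + 1) * 2 ^ (k + 1) ∧
        Disjoint (P.internalVertices K K') (Z : Set (Fin n))

open Classical in
theorem card_not_adj_le {n : ℕ} (G : SimpleGraph (Fin n)) [DecidableRel G.Adj] (v : Fin n) :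
    (Finset.univ.filter fun u => ¬ G.Adj v u).card ≤ n - G.minDegree := by
  have h1 := Finset.card_filter_add_card_filter_not (s := (Finset.univ : Finset (Fin n)))
    (fun u => G.Adj v u)
  have h2 := G.minDegree_le_degree v
  have h3 : G.degree v = (Finset.univ.filter fun u => G.Adj v u).card := by
    rw [← SimpleGraph.card_neighborFinset_eq_degree, SimpleGraph.neighborFinset_eq_filter]
  rw [Finset.card_univ, Fintype.card_fin] at h1
  omega

theorem binomialRandom_not_hasConnectingPaths_le (k : ℕ) {ε : ℝ} (hε : 0 < ε) :
    ∃ (C : ℝ) (n₀ : ℕ), ∀ n ≥ n₀, ∀ (G : SimpleGraph (Fin n)) [DecidableRel G.Adj] (p : I),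
      ((k : ℝ) / ((k : ℝ) + 1) + ε) * (n : ℝ) ≤ (G.minDegree : ℝ) → C / n ≤ (p : ℝ) →
      SimpleGraph.binomialRandom (Fin n) p {Γ | ¬ HasConnectingPaths k ε G Γ} ≤
        ENNReal.ofReal ((((k + 1) * 2 ^ (k + 1) : ℕ) : ℝ) * Real.exp (-n)) := by
  classical
  -- Of the slack εn in the degree condition, Z takes at most εn/2 and the two cliques at most 2(k +
  -- 1) ≤ εn/4, so εn/4 remains.
  obtain ⟨c, hc, hdense⟩ := density_tupleConnects k (ε / 4) (by positivity)
  set M := (k + 1) * 2 ^ (k + 1) with hM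
  -- The decay rate is one more than the exponent 2(k + 1) + 1 in the bound for the number of
  -- triples (K, K', Z). The density c/2 is what remains of c after discarding non-injective tuples.
  obtain ⟨C, n₀, hbraid⟩ := binomialRandom_braid (r := k + 1) (by omega)
    (2 * ((k + 1 : ℕ) : ℝ) + 2) M (c / 2) (by positivity)
  refine ⟨C, max (max n₀ 1) (max ⌈M ^ 2 * 2 / c⌉₊ ⌈8 * (k + 1) / ε⌉₊), fun n hn G _ p hG hp => ?_⟩
  simp only [ge_iff_le, max_le_iff] at hn
  obtain ⟨⟨hn₀, hn1⟩, hnM, hnk⟩ := hn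
  have hn0 : (0 : ℝ) < n := by exact_mod_cast hn1
  have hnM : (M : ℝ) ^ 2 / n ≤ c / 2 := by
    have := (Nat.le_ceil _).trans (Nat.cast_le (α := ℝ).2 hnM)
    rw [div_le_iff₀ hc] at this
    rw [div_le_iff₀ hn0]
    linarith
  have hnk : 8 * ((k : ℝ) + 1) ≤ ε * n := by
    have := (Nat.le_ceil _).trans (Nat.cast_le (α := ℝ).2 hnk)
    rwa [div_le_iff₀' hε] at this
  rw [div_le_iff₀ hn0] at hp
  set d := n - G.minDegree with hd
  have hdeg : ((k : ℝ) + 1) * d ≤ n - ε * n := by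
    have h1 : G.minDegree ≤ n := by
      have : NeZero n := ⟨by omega⟩
      exact (G.minDegree_le_degree 0).trans ((G.degree_lt_card_verts 0).le.trans_eq (by simp))
    have h2 : (d : ℝ) = n - G.minDegree := by rw [hd, Nat.cast_sub h1]
    have hk : (0 : ℝ) < k + 1 := by positivity
    have h3 : ((k : ℝ) + 1) * d ≤ (k + 1) * (n - (k / (k + 1) + ε) * n) := by
      rw [h2]
      gcongr
    have h4 : ((k : ℝ) + 1) * (n - (k / (k + 1) + ε) * n) = n - (k + 1) * (ε * n) := by
      field_simp
      ring
    have h5 : (0 : ℝ) ≤ k * (ε * n) := by positivity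
    linarith
  let U : (Fin (k + 1) → Fin n) × (Fin (k + 1) → Fin n) × Finset (Fin n) → Finset (Fin n) :=
    fun x => Finset.univ \ (x.2.2 ∪ (Finset.univ.image x.1 ∪ Finset.univ.image x.2.1))
  let F : (Fin (k + 1) → Fin n) × (Fin (k + 1) → Fin n) × Finset (Fin n) →
      (Fin M → Fin n) → Prop := fun x f =>
    ((∀ t, f t ∈ U x) ∧ TupleConnects G x.1 x.2.1 f) ∧ Function.Injective f
  let I' := Finset.univ.filter fun x : (Fin (k + 1) → Fin n) × (Fin (k + 1) → Fin n) ×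
    Finset (Fin n) => (x.2.2.card : ℝ) ≤ ε * n / 2
  have hF : ∀ x ∈ I', HasDensity (c / 2) (F x) := by
    intro x hx
    have hx : (x.2.2.card : ℝ) ≤ ε * n / 2 := by simpa [I'] using hx
    have hU : ε / 4 * Fintype.card (Fin n) + ((k : ℝ) + 1) * d ≤ (U x).card := by
      have h1 : n ≤ (U x).card + (x.2.2.card + ((k + 1) + (k + 1))) := by
        have h2 := Finset.le_card_sdiff
          (x.2.2 ∪ (Finset.univ.image x.1 ∪ Finset.univ.image x.2.1)) Finset.univ
        have h3 := (Finset.card_union_le x.2.2 (Finset.univ.image x.1 ∪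
          Finset.univ.image x.2.1)).trans (Nat.add_le_add_left ((Finset.card_union_le _ _).trans
            (Nat.add_le_add Finset.card_image_le Finset.card_image_le)) _)
        rw [Finset.card_univ, Fintype.card_fin] at h2 h3
        change _ ≤ (U x).card at h2
        omega
      have h2 : (n : ℝ) ≤ (U x).card + (x.2.2.card + ((k + 1) + (k + 1))) := by exact_mod_cast h1
      rw [Fintype.card_fin]
      linarith
    exact ((hdense (Fin n) G d (fun v => by convert card_not_adj_le G v) (U x) x.1 x.2.1 hU).inter
      ((density_injective hn1).mono_left (by linarith : 1 - c / 2 ≤ _))).mono_left (by linarith)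
  have hcover : {Γ | ¬ HasConnectingPaths k ε G Γ} ⊆ ⋃ x ∈ I', {Γ : SimpleGraph (Fin n) |
      ¬ ∃ f, F x f ∧ ∀ i j : Fin M, (i : ℕ) + (k + 1) = j → Γ.Adj (f i) (f j)} := by
    intro Γ hΓ
    by_contra hcon
    refine hΓ fun Z hZ K K' hK hK' hKK' => ?_
    obtain ⟨f, ⟨⟨hfU, hconn⟩, hinj⟩, hΓf⟩ := not_not.1 fun h =>
      hcon (Set.mem_iUnion₂.2 ⟨(K, K', Z), by simpa [I'] using hZ, h⟩)
    simp only [U, Finset.mem_sdiff, Finset.mem_univ, true_and, Finset.mem_union, Finset.mem_image,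
      not_or, not_exists] at hfU
    have hrM : k + 1 ≤ M := Nat.le_mul_of_pos_right _ (by positivity)
    obtain ⟨P, hP, hint⟩ := hconn.exists_powerPath hrM hK hK' hKK' hinj
      (fun t i h => (hfU t).2.1 i h.symm) (fun t i h => (hfU t).2.2 i h.symm) hΓf
    refine ⟨P, hP, ?_, ?_⟩
    · rw [hint, ← Set.image_univ, Set.ncard_image_of_injective _ hinj, Set.ncard_univ,
        Nat.card_eq_fintype_card, Fintype.card_fin]
    · rw [hint, Set.disjoint_left]
      rintro _ ⟨t, rfl⟩ ht
      exact (hfU t).1 ht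
  refine (measure_mono hcover).trans ((measure_biUnion_finset_le _ _).trans
    ((Finset.sum_le_card_nsmul _ _ _ fun x hx => hbraid n hn₀ p hp _ (hF x hx)).trans ?_))
  rw [nsmul_eq_mul, ← ENNReal.ofReal_natCast, ← ENNReal.ofReal_mul (by positivity)]
  refine ENNReal.ofReal_le_ofReal ?_
  have hcard : (I'.card : ℝ) ≤ Real.exp ((2 * ((k + 1 : ℕ) : ℝ) + 1) * n) := by
    have h1 : I'.card ≤ n ^ (k + 1) * (n ^ (k + 1) * 2 ^ n) :=
      (Finset.card_le_univ _).trans (by simp)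
    have h2 : (n : ℝ) ≤ Real.exp n := by linarith [Real.add_one_le_exp (n : ℝ)]
    have h3 : (2 : ℝ) ≤ Real.exp 1 := by linarith [Real.add_one_le_exp (1 : ℝ)]
    calc (I'.card : ℝ) ≤ (n : ℝ) ^ (k + 1) * ((n : ℝ) ^ (k + 1) * 2 ^ n) := by exact_mod_cast h1
      _ ≤ Real.exp n ^ (k + 1) * (Real.exp n ^ (k + 1) * Real.exp 1 ^ n) := by gcongr
      _ = _ := by
        rw [← Real.exp_nat_mul, ← Real.exp_nat_mul, ← Real.exp_add, ← Real.exp_add]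
        congr 1
        ring
  calc (I'.card : ℝ) * (M * Real.exp (-((2 * ((k + 1 : ℕ) : ℝ) + 2) * n)))
      ≤ Real.exp ((2 * ((k + 1 : ℕ) : ℝ) + 1) * n) *
        (M * Real.exp (-((2 * ((k + 1 : ℕ) : ℝ) + 2) * n))) := by gcongr
    _ = M * (Real.exp ((2 * ((k + 1 : ℕ) : ℝ) + 1) * n) *
        Real.exp (-((2 * ((k + 1 : ℕ) : ℝ) + 2) * n))) := by ring
    _ = M * Real.exp (-n) := by
        rw [← Real.exp_add]
        congr 2
        ring

theorem proposition2p1 (k : ℕ) (ε : ℝ) (hε : 0 < ε) :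
    ∃ C : ℝ, 1 < C ∧
      ∀ (G : (n : ℕ) → SimpleGraph (Fin n)) [∀ n, DecidableRel (G n).Adj] (p : ℕ → unitInterval),
        (∀ᶠ n : ℕ in Filter.atTop,
          ((k : ℝ) / ((k : ℝ) + 1) + ε) * (n : ℝ) ≤ ((G n).minDegree : ℝ)) →
        (∀ᶠ n : ℕ in Filter.atTop, C / (n : ℝ) ≤ (p n : ℝ)) →
        Filter.Tendsto
          (fun n : ℕ => SimpleGraph.binomialRandom (Fin n) (p n)
            {Γ : SimpleGraph (Fin n) |
              ∀ Z : Finset (Fin n), (Z.card : ℝ) ≤ ε * (n : ℝ) / 2 →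
              ∀ K K' : Fin (k + 1) → Fin n,
                IsOrderedClique (G n ⊔ Γ) K → IsOrderedClique (G n ⊔ Γ) K' →
                Disjoint (Set.range K) (Set.range K') →
                ∃ P : PowerPath (G n ⊔ Γ) (k + 1),
                  P.Connects K K' ∧
                  (P.internalVertices K K').ncard = (k + 1) * 2 ^ (k + 1) ∧
                  Disjoint (P.internalVertices K K') (Z : Set (Fin n))})
          Filter.atTop (nhds 1) := by
  obtain ⟨C, n₀, h⟩ := binomialRandom_not_hasConnectingPaths_le k hε
  -- The maximum with 2 only secures 1 < C.
  refine ⟨max C 2, lt_of_lt_of_le one_lt_two (le_max_right _ _), fun G _ p hG hp => ?_⟩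
  set M : ℝ := (((k + 1) * 2 ^ (k + 1) : ℕ) : ℝ)
  have hlim : Filter.Tendsto (fun n : ℕ => 1 - ENNReal.ofReal (M * Real.exp (-(n : ℝ))))
      Filter.atTop (nhds 1) := by
    have h1 : Filter.Tendsto (fun n : ℕ => M * Real.exp (-(n : ℝ))) Filter.atTop (nhds 0) := by
      have := (Real.tendsto_exp_neg_atTop_nhds_zero.comp
        tendsto_natCast_atTop_atTop).const_mul M
      simpa using this
    have h2 := ENNReal.Tendsto.sub (tendsto_const_nhds (x := (1 : ENNReal)))
      (ENNReal.tendsto_ofReal h1) (Or.inl ENNReal.one_ne_top)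
    simpa using h2
  refine tendsto_of_tendsto_of_tendsto_of_le_of_le' hlim tendsto_const_nhds ?_
    (Filter.Eventually.of_forall fun n => prob_le_one)
  filter_upwards [hG, hp, Filter.eventually_ge_atTop n₀] with n hGn hpn hn
  have hbad := h n hn (G n) (p n) hGn
    ((div_le_div_of_nonneg_right (le_max_left C 2) (Nat.cast_nonneg n)).trans hpn)
  rw [tsub_le_iff_right]
  calc (1 : ENNReal) = SimpleGraph.binomialRandom (Fin n) (p n) Set.univ := measure_univ.symm
    _ ≤ SimpleGraph.binomialRandom (Fin n) (p n) {Γ | HasConnectingPaths k ε (G n) Γ} +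
        SimpleGraph.binomialRandom (Fin n) (p n) {Γ | ¬ HasConnectingPaths k ε (G n) Γ} := by
      refine (measure_mono fun Γ _ => ?_).trans (measure_union_le _ _)
      exact em (HasConnectingPaths k ε (G n) Γ)
    _ ≤ _ := add_le_add (le_of_eq rfl) hbad
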